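/- Let $H(\omega_1)$ be the family of hereditarily countable sets and let $\prec^*$ be a well-ordering of $H(\omega_1)$ (e.g. the restriction of a fixed well-ordering of $H(\mathfrak c^+)$); put $N=(H(\omega_1);\in,\prec^*)$. A sequence $\langle *_\alpha:\alpha<\omega_1\rangle$ of elements of $H(\omega_1)$ is called continuous if $*_\alpha=\{*_\beta:\beta<\alpha\}$ for every limit $\alpha<\omega_1$. Let $\operatorname{non}(\mathcal M)$ be the invariant $(\mathcal M,2^\omega,\not\ni)$, where $\mathcal M$ is the ideal of meagre subsets of $2^\omega$, represented over $N$ by codes in $H(\omega_1)$: a code is a (countable) family $a\in H(\omega_1)$ of dense subsets of the partial order $2^{<\omega}$, it codes the meagre set $\{x\in 2^\omega:\exists D\in a\;\forall k<\omega\; x\restriction k\notin D\}$, and every meagre set is contained in a coded one. Thus, for an elementary submodel $M$ of $N$, the relation "$\mathcal M\cap M\not\ni b$" means that $b\in 2^\omega$ belongs to no meagre set with a code in $M$, i.e. $b$ is a Cohen real over $M$. The elementary diamond $\diamondsuit_{\mathrm{EL}}(\operatorname{non}(\mathcal M))$ is the following principle: for every sequence $\langle h_\alpha:\alpha<\omega_1\rangle$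 of elements of $H(\omega_1)$ there is a sequence $\langle b_\alpha:\alpha<\omega_1\rangle$ of elements of $2^\omega$ such that for every continuous sequence $\langle *_\alpha:\alpha<\omega_1\rangle$ of elements of $H(\omega_1)$ there is a $\subseteq$-increasing chain $\langle M_\alpha:\alpha<\omega_1\rangle$ of elementary submodels of $N$ satisfying 1. $\{*_\alpha,\ h_\alpha,\ \{M_\beta:\beta<\alpha\}\}\in M_{\alpha+1}$ for every $\alpha<\omega_1$, and 2. the set $\{\alpha<\omega_1: b_\alpha \text{ is a Cohen real over } M_{\alpha+1}\}$ is stationary in $\omega_1$. **Theorem.** If $\diamondsuit_{\mathrm{EL}}(\operatorname{non}(\mathcal M))$ holds, then there exists a Suslin tree, that is, a set $T\subseteq 2^{<\omega_1}$ closed under initial segments, with elements of every length $\alpha<\omega_1$, such that every chain and every antichain of $T$ (with respect to the initial segment order) is countable. -/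

import Mathlib

open scoped Ordinal

namespace ElementaryDiamond

/-! ### The structure `(H(ω₁); ∈, ≺*)` -/

/-- The transitive closure of a set `x`. -/
def transClosure (x : ZFSet.{0}) : Set ZFSet.{0} :=
  {y | Relation.TransGen (fun u v : ZFSet.{0} => u ∈ v) y x}

/-- `x ∈ H(ω₁)`: the transitive closure of `x` is countable. -/
def IsHC (x : ZFSet.{0}) : Prop := (transClosure x).Countable

/-- `H(ω₁)`, the family of hereditarily countable sets. -/
abbrev HC : Type 1 := {x : ZFSet.{0} // IsHC x}

/-- The relation symbols `∈` and `≺*`, both binary. -/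
inductive Rel : ℕ → Type
  | mem : Rel 2
  | wo : Rel 2

/-- The first-order language `{∈, ≺*}`. -/
abbrev lang : FirstOrder.Language := ⟨fun _ => Empty, Rel⟩

/-- The structure `(H(ω₁); ∈, ≺*)`, where `r` is the relation `≺*`. -/
abbrev hcStructure (r : HC → HC → Prop) : lang.Structure HC where
  funMap := fun f => f.elim
  RelMap := fun {_} R =>
    match R with
    | Rel.mem => fun v => (v 0).1 ∈ (v 1).1
    | Rel.wo => fun v => r (v 0) (v 1)

/-- The set `m` is (the universe of) an elementary submodel of `(H(ω₁); ∈, ≺*)`. -/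
def IsElementarySubmodel (r : HC → HC → Prop) (m : ZFSet.{0}) : Prop :=
  (∀ x ∈ m, IsHC x) ∧
    letI := hcStructure r
    ∃ S : lang.ElementarySubstructure HC, (S : Set HC) = {x : HC | x.1 ∈ m}

/-! ### Invariants and the elementary diamond -/

/-- An invariant `(A, B, E)` whose first coordinate is (coded by) a subset of `H(ω₁)`. -/
structure Invariant where
  A : Set HC
  B : Type
  E : HC → B → Prop
  exists_rel : ∀ a ∈ A, ∃ b, E a b
  exists_not_rel : ∀ b, ∃ a ∈ A, ¬ E a b

/-- `s` (restricted to `ω₁`) is a continuous `ω₁`-sequence of elements of `H(ω₁)`. -/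
def IsContinuousSeq (s : Ordinal.{0} → ZFSet.{0}) : Prop :=
  (∀ α < ω₁, IsHC (s α)) ∧
    ∀ α < ω₁, Order.IsSuccLimit α → s α = ZFSet.range (fun β : Set.Iio α => s β)

/-- The elementary diamond `◇_EL(A, B, E)` over the structure `(H(ω₁); ∈, ≺*)`, where `r` is `≺*`.
All sequences are `ω₁`-sequences: only their values at ordinals below `ω₁` are used. -/
def ELDiamond (r : HC → HC → Prop) (I : Invariant) : Prop :=
  ∀ h : Ordinal.{0} → HC, ∃ b : Ordinal.{0} → I.B,
    ∀ s : Ordinal.{0} → ZFSet.{0}, IsContinuousSeq s →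
      ∃ M : Ordinal.{0} → ZFSet.{0},
        (∀ α < ω₁, IsElementarySubmodel r (M α)) ∧
        (∀ α β, α ≤ β → β < ω₁ → M α ⊆ M β) ∧
        (∀ α < ω₁,
          ({s α, (h α).1, ZFSet.range (fun β : Set.Iio α => M β)} : ZFSet.{0}) ∈
            M (Order.succ α)) ∧
        IsStationary {α : Set.Iio (ω₁ : Ordinal.{0}) |
          ∀ a ∈ I.A, a.1 ∈ M (Order.succ α.1) → I.E a (b α.1)}

/-! ### The invariant `non(M)` on Cantor space -/

/-- The finite sequence `x ↾ k ∈ 2^{<ω}` as a set: the set of all pairs `(i, x i)` with `i < k`. -/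
noncomputable def restr (x : ℕ → Bool) (k : ℕ) : ZFSet.{0} :=
  ZFSet.range (fun i : Fin k =>
    ZFSet.pair (Ordinal.toZFSet (i : ℕ)) (Ordinal.toZFSet (if x i then 1 else 0)))

/-- `D` is a dense subset of the partial order `2^{<ω}`. -/
def IsDenseSet (D : ZFSet.{0}) : Prop :=
  (∀ d ∈ D, ∃ (x : ℕ → Bool) (k : ℕ), d = restr x k) ∧
    ∀ (x : ℕ → Bool) (k : ℕ), ∃ (y : ℕ → Bool) (n : ℕ), k ≤ n ∧ (∀ i < k, y i = x i) ∧ restr y n ∈ D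

/-- Codes for meagre sets of reals: the elements of `H(ω₁)` that are (necessarily countable)
families of dense subsets of `2^{<ω}`. -/
def meagreCodes : Set HC := {a | ∀ D ∈ a.1, IsDenseSet D}

/-- The meagre (`F_σ`) subset of `2^ω` coded by `a`: the reals that fail to meet some member
of `a`. -/
def decode (a : HC) : Set (ℕ → Bool) := {x | ∃ D ∈ a.1, ∀ k, restr x k ∉ D}

theorem restr_inj {x y : ℕ → Bool} {k n : ℕ} (h : restr x k = restr y n) :
    k = n ∧ ∀ i < k, x i = y i := by
  have key : ∀ {x y : ℕ → Bool} {k n : ℕ}, restr x k = restr y n →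
      ∀ i < k, i < n ∧ x i = y i := by
    intro x y k n h i hi
    have h1 : ZFSet.pair (Ordinal.toZFSet ((i : ℕ) : Ordinal.{0}))
        (Ordinal.toZFSet (if x i then 1 else 0)) ∈ restr x k :=
      ZFSet.mem_range.2 ⟨⟨i, hi⟩, rfl⟩
    rw [h] at h1
    obtain ⟨j, hj⟩ := ZFSet.mem_range.1 h1
    obtain ⟨h2, h3⟩ := ZFSet.pair_inj.1 hj
    have h4 : (j : ℕ) = i := by
      have := Ordinal.toZFSet_injective h2
      exact_mod_cast this
    have h5 := Ordinal.toZFSet_injective h3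
    rw [h4] at h5
    refine ⟨h4 ▸ j.2, ?_⟩
    cases hx : x i <;> cases hy : y i <;> simp_all
  refine ⟨le_antisymm ?_ ?_, fun i hi => (key h i hi).2⟩
  · by_contra hc
    exact absurd (key h n (by omega)).1 (lt_irrefl _)
  · by_contra hc
    exact absurd (key h.symm k (by omega)).1 (lt_irrefl _)

theorem isHC_of_forall_mem {x : ZFSet.{0}} (hx : {y | y ∈ x}.Countable)
    (h : ∀ y ∈ x, IsHC y) : IsHC x := by
  have : transClosure x ⊆ ⋃ y ∈ {y | y ∈ x}, insert y (transClosure y) := by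
    intro z hz
    obtain ⟨w, h1, h2⟩ := Relation.TransGen.tail'_iff.1 hz
    rcases Relation.reflTransGen_iff_eq_or_transGen.1 h1 with rfl | h1
    · exact Set.mem_biUnion (x := w) h2 (Set.mem_insert _ _)
    · exact Set.mem_biUnion (x := w) h2 (Set.mem_insert_of_mem _ h1)
  exact (hx.biUnion fun y hy => (h y hy).insert y).mono this

theorem isHC_natCast (n : ℕ) : IsHC (Ordinal.toZFSet (n : Ordinal.{0})) := by
  induction n using Nat.strong_induction_on with
  | _ n ih =>
    have hm : ∀ y ∈ Ordinal.toZFSet (n : Ordinal.{0}), ∃ m < n, y = Ordinal.toZFSet (m : ℕ) := by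
      intro y hy
      obtain ⟨a, ha, rfl⟩ := Ordinal.mem_toZFSet_iff.1 hy
      obtain ⟨m, rfl⟩ := Ordinal.lt_omega0.1 (ha.trans (Ordinal.natCast_lt_omega0 n))
      exact ⟨m, by exact_mod_cast ha, rfl⟩
    refine isHC_of_forall_mem ?_ fun y hy => ?_
    · refine (Set.countable_range fun m : ℕ => Ordinal.toZFSet (m : Ordinal.{0})).mono ?_
      intro y hy
      obtain ⟨m, -, rfl⟩ := hm y hy
      exact ⟨m, rfl⟩
    · obtain ⟨m, h, rfl⟩ := hm y hy
      exact ih m h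

theorem isHC_pair {x y : ZFSet.{0}} (hx : IsHC x) (hy : IsHC y) : IsHC (ZFSet.pair x y) := by
  have h2 : ∀ u v : ZFSet.{0}, IsHC u → IsHC v → IsHC {u, v} := by
    intro u v hu hv
    refine isHC_of_forall_mem ((Set.toFinite {u, v}).countable.mono ?_) ?_
    · intro z hz; simpa using hz
    · intro z hz
      rcases ZFSet.mem_pair.1 hz with rfl | rfl <;> assumption
  have := h2 {x, x} {x, y} (h2 _ _ hx hx) (h2 _ _ hx hy)
  simpa [ZFSet.pair] using this

theorem isHC_restr (x : ℕ → Bool) (k : ℕ) : IsHC (restr x k) := by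
  refine isHC_of_forall_mem ?_ ?_
  · refine (Set.countable_range (fun i : Fin k => ZFSet.pair
      (Ordinal.toZFSet ((i : ℕ) : Ordinal.{0})) (Ordinal.toZFSet (if x i then 1 else 0)))).mono ?_
    intro z hz
    exact ZFSet.mem_range.1 hz
  · intro z hz
    obtain ⟨i, rfl⟩ := ZFSet.mem_range.1 hz
    refine isHC_pair (isHC_natCast _) ?_
    split_ifs
    · simpa using isHC_natCast 1
    · simpa using isHC_natCast 0

theorem restr_congr {x y : ℕ → Bool} {k : ℕ} (h : ∀ i < k, x i = y i) :
    restr x k = restr y k := by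
  unfold restr
  congr 1
  funext i
  rw [h i i.2]

/-- The finite sequences `x ↾ k` with property `P` form a hereditarily countable set. -/
theorem exists_set (P : ZFSet.{0} → Prop) :
    ∃ D : ZFSet.{0}, IsHC D ∧ ∀ z, z ∈ D ↔ (∃ x k, z = restr x k) ∧ P z := by
  have hc : {z : ZFSet.{0} | ∃ x k, z = restr x k}.Countable := by
    refine (Set.countable_range fun l : List Bool =>
      restr (fun i => l.getD i false) l.length).mono ?_
    rintro _ ⟨x, k, rfl⟩
    refine ⟨List.ofFn fun i : Fin k => x i, ?_⟩
    simp only [List.length_ofFn]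
    exact restr_congr fun i hi => by simp [List.getD, hi]
  set S := {z : ZFSet.{0} | (∃ x k, z = restr x k) ∧ P z}
  have hS : S.Countable := hc.mono fun z hz => hz.1
  have : Countable S := hS.to_subtype
  have hm : ∀ z, z ∈ ZFSet.range (fun z : S => z.1) ↔ z ∈ S := by simp
  refine ⟨ZFSet.range (fun z : S => z.1), isHC_of_forall_mem ?_ ?_, hm⟩
  · exact hS.mono fun z hz => (hm z).1 hz
  · intro z hz
    obtain ⟨⟨x, k, rfl⟩, -⟩ := (hm z).1 hz
    exact isHC_restr x k

theorem countable_mem (a : HC) : {D | D ∈ a.1}.Countable :=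
  a.2.mono fun _ hD => Relation.TransGen.single hD

theorem isOpen_cylinder (x : ℕ → Bool) (k : ℕ) : IsOpen {y : ℕ → Bool | ∀ i < k, y i = x i} := by
  have : {y : ℕ → Bool | ∀ i < k, y i = x i} = ⋂ i ∈ Finset.range k, {y | y i = x i} := by
    ext; simp
  rw [this]
  refine isOpen_biInter_finset fun i _ => ?_
  exact (isOpen_discrete ({x i} : Set Bool)).preimage (continuous_apply (A := fun _ : ℕ => Bool) i)

theorem exists_cylinder {U : Set (ℕ → Bool)} (hU : IsOpen U) {x : ℕ → Bool} (hx : x ∈ U) :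
    ∃ k, {y : ℕ → Bool | ∀ i < k, y i = x i} ⊆ U := by
  obtain ⟨I, u, h1, h2⟩ := isOpen_pi_iff.1 hU x hx
  refine ⟨I.sup id + 1, fun y hy => h2 fun i hi => ?_⟩
  rw [hy i (Nat.lt_succ_of_le (Finset.le_sup (f := id) hi))]
  exact (h1 i hi).2

/-- Every code codes a meagre set. -/
theorem isMeagre_decode {a : HC} (ha : a ∈ meagreCodes) : IsMeagre (decode a) := by
  have : decode a = ⋃ D ∈ {D | D ∈ a.1}, {x | ∀ k, restr x k ∉ D} := by
    ext x; simp [decode]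
  rw [this, IsMeagre, Set.compl_iUnion₂]
  refine (countable_bInter_mem (countable_mem a)).2 fun D hD => ?_
  refine residual_of_dense_open ?_ ?_
  · refine isOpen_iff_forall_mem_open.2 fun x hx => ?_
    obtain ⟨k, hk⟩ : ∃ k, restr x k ∈ D := by simpa using hx
    refine ⟨_, fun y hy => ?_, isOpen_cylinder x k, fun _ _ => rfl⟩
    have : restr y k ∈ D := by rwa [restr_congr hy]
    simpa using ⟨k, this⟩
  · refine dense_iff_inter_open.2 fun U hU hne => ?_
    obtain ⟨x, hx⟩ := hne
    obtain ⟨k, hk⟩ := exists_cylinder hU hx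
    obtain ⟨y, n, -, hy, hn⟩ := (ha D hD).2 x k
    exact ⟨y, hk hy, by simpa using ⟨n, hn⟩⟩

/-- Every meagre set is contained in a coded one. -/
theorem exists_subset_decode {s : Set (ℕ → Bool)} (hs : IsMeagre s) :
    ∃ a ∈ meagreCodes, s ⊆ decode a := by
  obtain ⟨S, hS, hSc, hsub⟩ := isMeagre_iff_countable_union_isNowhereDense.1 hs
  choose D hD hDm using fun t : Set (ℕ → Bool) =>
    exists_set fun z => ∃ x k, z = restr x k ∧ {y | ∀ i < k, y i = x i} ∩ t = ∅
  have : Countable S := hSc.to_subtype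
  have hm : ∀ z, z ∈ ZFSet.range (fun t : S => D t) ↔ ∃ t ∈ S, D t = z := by simp
  refine ⟨⟨ZFSet.range (fun t : S => D t), isHC_of_forall_mem ?_ ?_⟩, ?_, ?_⟩
  · exact (hSc.image D).mono fun z hz => (hm z).1 hz
  · intro z hz
    obtain ⟨t, -, rfl⟩ := (hm z).1 hz
    exact hD t
  · intro z hz
    obtain ⟨t, ht, rfl⟩ := (hm z).1 hz
    refine ⟨fun d hd => ((hDm t d).1 hd).1, fun x k => ?_⟩
    have hcl : ¬ {y : ℕ → Bool | ∀ i < k, y i = x i} ⊆ closure t := by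
      intro hsubset
      have h1 := interior_maximal hsubset (isOpen_cylinder x k)
      rw [hS t ht] at h1
      exact h1 (show x ∈ {y : ℕ → Bool | ∀ i < k, y i = x i} from fun _ _ => rfl)
    obtain ⟨y, hy, hyt⟩ := Set.not_subset.1 hcl
    obtain ⟨n, hn⟩ := exists_cylinder isClosed_closure.isOpen_compl hyt
    refine ⟨y, max k n, le_max_left _ _, hy, (hDm t _).2 ⟨⟨y, _, rfl⟩, y, _, rfl, ?_⟩⟩
    refine Set.eq_empty_of_forall_notMem fun w hw => ?_
    exact hn (fun i hi => hw.1 i (lt_of_lt_of_le hi (le_max_right _ _))) (subset_closure hw.2)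
  · intro x hx
    obtain ⟨t, ht, hxt⟩ := hsub hx
    refine ⟨D t, (hm _).2 ⟨t, ht, rfl⟩, fun k hk => ?_⟩
    obtain ⟨-, y, n, hyn, he⟩ := (hDm t _).1 hk
    obtain ⟨rfl, hxy⟩ := restr_inj hyn
    exact Set.notMem_empty x (he ▸ (⟨hxy, hxt⟩ : x ∈ {w | ∀ i < k, w i = y i} ∩ t))

/-- The invariant `non(M) = (M, 2^ω, ∌)`, with the meagre sets represented by their codes
in `H(ω₁)`. -/
def nonM : Invariant where
  A := meagreCodes
  B := ℕ → Bool
  E a b := b ∉ decode a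
  exists_rel a ha := by
    by_contra! h
    exact not_isMeagre_of_isOpen isOpen_univ Set.univ_nonempty
      ((isMeagre_decode ha).mono fun x _ => h x)
  exists_not_rel b := by
    have hb : IsMeagre ({b} : Set (ℕ → Bool)) := by
      refine IsNowhereDense.isMeagre ?_
      rw [IsNowhereDense, closure_singleton]
      refine Set.eq_empty_of_forall_notMem fun x hx => ?_
      obtain ⟨k, hk⟩ := exists_cylinder isOpen_interior hx
      have hk' := hk.trans interior_subset
      have h1 : x = b := hk' fun _ _ => rfl
      have h2 : Function.update x k (!(x k)) = b :=
        hk' fun i hi => Function.update_of_ne (ne_of_lt hi) _ _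
      have h3 := congrFun (h2.trans h1.symm) k
      simp at h3
    obtain ⟨a, ha, h⟩ := exists_subset_decode hb
    exact ⟨a, ha, fun hn => hn (h rfl)⟩

/-! ### Suslin trees -/

/-- The elements of `2^{<ω₁}`. -/
structure BinSeq where
  len : Ordinal.{0}
  len_lt : len < ω₁
  val : Set.Iio len → Bool

/-- `s` is an initial segment of `t`. -/
def IsInit (s t : BinSeq) : Prop :=
  ∃ h : s.len ≤ t.len, ∀ β : Set.Iio s.len, s.val β = t.val ⟨β.1, lt_of_lt_of_le β.2 h⟩

/-- A tree `T ⊆ 2^{<ω₁}`: a nonempty set closed under initial segments. -/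
def IsTree (T : Set BinSeq) : Prop :=
  T.Nonempty ∧ ∀ t ∈ T, ∀ s, IsInit s t → s ∈ T

/-- The `α`-th level of a tree. -/
def level (T : Set BinSeq) (α : Ordinal.{0}) : Set BinSeq := {t ∈ T | t.len = α}

/-- A Suslin tree: a tree of height `ω₁` all of whose chains and antichains are countable. -/
structure IsSuslinTree (T : Set BinSeq) : Prop where
  isTree : IsTree T
  height : ∀ α < ω₁, (level T α).Nonempty
  countable_chain : ∀ C ⊆ T, (∀ s ∈ C, ∀ t ∈ C, IsInit s t ∨ IsInit t s) → C.Countable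
  countable_antichain :
    ∀ C ⊆ T, (∀ s ∈ C, ∀ t ∈ C, s ≠ t → ¬ IsInit s t ∧ ¬ IsInit t s) → C.Countable

end ElementaryDiamond

namespace ElementaryDiamond

/-! ### Elementary submodels -/

/-! The tree consists of the finite modifications of a coherent sequence of functions `x α` on `α`.
At a limit `α` the function is glued along a ladder `a`: on the `n`-th interval it is `x (a n)`
switched on the finite set `dec (rowIdx b n)`, where `b` is the real that the diamond assigns to
`α`, read as a sequence of natural numbers. Levels of such a tree are countable, and it is Suslin as
soon as each dense open set `E` contains a whole level (`isSuslinTree_tree`).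

Fix `E`, and let `α` be a limit such that nodes below `α` extend into `E` below `α` and `b` is Cohen
over `M (α + 1)`. A node of level `α` is `x α` switched on a finite set `F`. Any finite part of `b`
can be extended so that the switched branch runs into `E` (`exists_decides_passes`): extend the node
fixed so far into `E`, then let the next finite sets steer the branch along that extension. So the
set `d` of conditions that put the branch into `E` is dense. If `{d}` belongs to `M (α + 1)`, then
`b` meets `d` and the node lies in `E`.

The difficulty is to put `d` into the model. The sequence `h` is fixed before `b`, so it cannot
mention `x` or `E`; the continuous sequence `s` may mention them, but its limit values are forced
and its earlier values serve all later `α` at once, so it cannot single out the ladder of `α`. Both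
therefore list tokens: a condition, a finite set and a finite description of a gluing. `h α` lists
the tokens arising from the ladder of `α`, `s` lists at successors the tokens whose node lies in
`E`, and `d` is definable from the two and the code of `F` (`IsElementarySubmodel.singleton_mem`).
On a club of `α` the codes of finite objects below `α` are below `α`, so all tokens needed are
listed in time (`level_subset_of_cohen`). -/

open FirstOrder Language in
/-- The atomic formula `x ∈ y`. -/
def memFormula {α : Type*} {n : ℕ} (x y : lang.Term (α ⊕ Fin n)) : lang.BoundedFormula α n :=
  Relations.boundedFormula₂ (Rel.mem : lang.Relations 2) x y

open FirstOrder Language in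
theorem realize_memFormula (r : HC → HC → Prop) {α : Type*} {n : ℕ} (x y : lang.Term (α ⊕ Fin n))
    (v : α → HC) (xs : Fin n → HC) :
    letI := hcStructure r
    (memFormula x y).Realize v xs ↔
      (x.realize (Sum.elim v xs)).1 ∈ (y.realize (Sum.elim v xs)).1 := by
  let _ := hcStructure r
  rw [memFormula, BoundedFormula.realize_rel₂]
  rfl

/-- An elementary submodel contains witnesses of the existential formulas with parameters in it. -/
theorem IsElementarySubmodel.exists_realize {r : HC → HC → Prop} {m : ZFSet.{0}}
    (hm : IsElementarySubmodel r m) {α β : Type} [Finite β] (φ : lang.Formula (α ⊕ β))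
    (v : α → HC) (hv : ∀ i, (v i).1 ∈ m) (w : β → HC) :
    letI := hcStructure r
    φ.Realize (Sum.elim v w) → ∃ w : β → HC, (∀ i, (w i).1 ∈ m) ∧ φ.Realize (Sum.elim v w) := by
  let _ := hcStructure r
  intro hw
  obtain ⟨-, S, hS⟩ := hm
  have hS' : ∀ x : HC, x ∈ S ↔ x.1 ∈ m := fun x => Set.ext_iff.1 hS x
  let v' : α → S := fun i => ⟨v i, (hS' _).2 (hv i)⟩
  have h1 : (φ.iExs β).Realize (S.subtype ∘ v') := FirstOrder.Language.Formula.realize_iExs.2 ⟨w, hw⟩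
  rw [S.subtype.map_formula, FirstOrder.Language.Formula.realize_iExs] at h1
  obtain ⟨w', hw'⟩ := h1
  rw [← S.subtype.map_formula] at hw'
  refine ⟨S.subtype ∘ w', fun i => (hS' _).1 (w' i).2, ?_⟩
  convert hw' using 1
  funext i
  cases i <;> rfl

theorem isHC_singleton {x : ZFSet.{0}} (hx : IsHC x) : IsHC {x} :=
  isHC_of_forall_mem ((Set.countable_singleton x).mono fun _ hy => ZFSet.mem_singleton.1 hy)
    fun _ hy => ZFSet.mem_singleton.1 hy ▸ hx

theorem IsHC.mem {x y : ZFSet.{0}} (hx : IsHC x) (h : y ∈ x) : IsHC y :=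
  hx.mono fun _ hz => Relation.TransGen.tail hz h

-- The statement that the triple has the form `{w 0, w 1, w 2}` reflects to the submodel; the
-- witnesses found there may come in another order, but each element of the triple equals one of
-- them.
open FirstOrder Language in
theorem IsElementarySubmodel.mem_of_triple_mem {r : HC → HC → Prop} {m : ZFSet.{0}}
    (hm : IsElementarySubmodel r m) {x y z : ZFSet.{0}} (h : ({x, y, z} : ZFSet.{0}) ∈ m) :
    x ∈ m ∧ y ∈ m ∧ z ∈ m := by
  let _ := hcStructure r
  have hT := hm.1 _ h
  have hx : IsHC x := hT.mem (by simp)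
  have hy : IsHC y := hT.mem (by simp)
  have hz : IsHC z := hT.mem (by simp)
  let t : Fin 1 ⊕ Fin 3 → lang.Term ((Fin 1 ⊕ Fin 3) ⊕ Fin 1) := fun i => Term.var (Sum.inl i)
  let φ : lang.Formula (Fin 1 ⊕ Fin 3) :=
    BoundedFormula.all ((memFormula (&0) (t (Sum.inl 0))).iff
      ((Term.bdEqual (&0) (t (Sum.inr 0)) ⊔ Term.bdEqual (&0) (t (Sum.inr 1))) ⊔
        Term.bdEqual (&0) (t (Sum.inr 2))))
  have hφ : ∀ (v : Fin 1 → HC) (w : Fin 3 → HC), φ.Realize (Sum.elim v w) ↔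
      ∀ c : HC, c.1 ∈ (v 0).1 ↔ (c = w 0 ∨ c = w 1) ∨ c = w 2 := by
    intro v w
    simp only [φ, t, Formula.Realize, BoundedFormula.realize_all, BoundedFormula.realize_iff,
      BoundedFormula.realize_sup, BoundedFormula.realize_bdEqual, realize_memFormula,
      Term.realize_var, Sum.elim_inl, Sum.elim_inr]
    rfl
  obtain ⟨w, hw, hr⟩ := hm.exists_realize φ (fun _ => ⟨_, hT⟩) (fun _ => h)
    ![⟨x, hx⟩, ⟨y, hy⟩, ⟨z, hz⟩] (by
      rw [hφ]
      intro c
      simp [Subtype.ext_iff, or_assoc])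
  rw [hφ] at hr
  have key : ∀ c, IsHC c → c ∈ ({x, y, z} : ZFSet.{0}) → c ∈ m := by
    intro c hc hmem
    rcases (hr ⟨c, hc⟩).1 hmem with (h1 | h1) | h1
    · have := hw 0
      rwa [← h1] at this
    · have := hw 1
      rwa [← h1] at this
    · have := hw 2
      rwa [← h1] at this
  exact ⟨key x hx (by simp), key y hy (by simp), key z hz (by simp)⟩

open FirstOrder Language in
/-- The singleton of the set `{c ∈ q | ∃ p ∈ k, ∃ u ∈ s, p ∈ u ∧ f ∈ p ∧ c ∈ p}` belongs to every
elementary submodel that contains `q`, `k`, `s` and `f`. -/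
theorem IsElementarySubmodel.singleton_mem {r : HC → HC → Prop} {m : ZFSet.{0}}
    (hm : IsElementarySubmodel r m) {q k s f d : ZFSet.{0}} (hq : q ∈ m) (hk : k ∈ m) (hs : s ∈ m)
    (hf : f ∈ m) (hd : IsHC d)
    (h : ∀ c, c ∈ d ↔ c ∈ q ∧ ∃ p ∈ k, ∃ u ∈ s, p ∈ u ∧ f ∈ p ∧ c ∈ p) :
    ({d} : ZFSet.{0}) ∈ m := by
  let _ := hcStructure r
  let t : Fin 4 ⊕ Fin 2 → ∀ n, lang.Term ((Fin 4 ⊕ Fin 2) ⊕ Fin n) := fun i n => Term.var (Sum.inl i)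
  -- The variables `inl 0, …, inl 3` are `q, k, s, f`; `inr 0` and `inr 1` stand for `d` and `{d}`,
  -- which the formula determines by extensionality. Quantifying `p` and `u` over `H(ω₁)` loses
  -- nothing because `H(ω₁)` is transitive.
  let φ : lang.Formula (Fin 4 ⊕ Fin 2) :=
    BoundedFormula.all ((memFormula (&0) (t (Sum.inr 1) 1)).iff
      (Term.bdEqual (&0) (t (Sum.inr 0) 1))) ⊓
    BoundedFormula.all ((memFormula (&0) (t (Sum.inr 0) 1)).iff
      (memFormula (&0) (t (Sum.inl 0) 1) ⊓ BoundedFormula.ex (BoundedFormula.ex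
        (((memFormula (&1) (t (Sum.inl 1) 3) ⊓ memFormula (&2) (t (Sum.inl 2) 3)) ⊓
          memFormula (&1) (&2)) ⊓ (memFormula (t (Sum.inl 3) 3) (&1) ⊓ memFormula (&0) (&1))))))
  have hφ : ∀ (v : Fin 4 → HC) (w : Fin 2 → HC), φ.Realize (Sum.elim v w) ↔
      (∀ c : HC, c.1 ∈ (w 1).1 ↔ c = w 0) ∧ ∀ c : HC, c.1 ∈ (w 0).1 ↔ c.1 ∈ (v 0).1 ∧
        ∃ p u : HC, ((p.1 ∈ (v 1).1 ∧ u.1 ∈ (v 2).1) ∧ p.1 ∈ u.1) ∧ (v 3).1 ∈ p.1 ∧ c.1 ∈ p.1 := by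
    intro v w
    simp only [φ, t, Formula.Realize, BoundedFormula.realize_all, BoundedFormula.realize_iff,
      BoundedFormula.realize_inf, BoundedFormula.realize_ex, BoundedFormula.realize_bdEqual,
      realize_memFormula, Term.realize_var, Sum.elim_inl, Sum.elim_inr]
    rfl
  have hds : IsHC {d} := isHC_singleton hd
  obtain ⟨w, hw, hr⟩ := hm.exists_realize φ
    ![⟨q, hm.1 _ hq⟩, ⟨k, hm.1 _ hk⟩, ⟨s, hm.1 _ hs⟩, ⟨f, hm.1 _ hf⟩]
    (by intro i; fin_cases i <;> assumption) ![⟨d, hd⟩, ⟨_, hds⟩] (by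
      rw [hφ]
      refine ⟨fun c => by simp [Subtype.ext_iff], fun c => (h c.1).trans (and_congr_right fun _ => ?_)⟩
      constructor
      · rintro ⟨p, hp, u, hu, h1, h2, h3⟩
        exact ⟨⟨p, (hm.1 _ hk).mem hp⟩, ⟨u, (hm.1 _ hs).mem hu⟩, ⟨⟨hp, hu⟩, h1⟩, h2, h3⟩
      · rintro ⟨p, u, ⟨⟨hp, hu⟩, h1⟩, h2, h3⟩
        exact ⟨p, hp, u, hu, h1, h2, h3⟩)
  rw [hφ] at hr
  obtain ⟨h1, h2⟩ := hr
  have hw0 : (w 0).1 = d := by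
    ext c
    refine ⟨fun hc => (h c).2 ?_, fun hc => ?_⟩
    · obtain ⟨h3, p, u, ⟨⟨hp, hu⟩, h4⟩, h5, h6⟩ := (h2 ⟨c, (w 0).2.mem hc⟩).1 hc
      exact ⟨h3, p, hp, u, hu, h4, h5, h6⟩
    · obtain ⟨h3, p, hp, u, hu, h4, h5, h6⟩ := (h c).1 hc
      exact (h2 ⟨c, hd.mem hc⟩).2 ⟨h3, ⟨p, (hm.1 _ hk).mem hp⟩, ⟨u, (hm.1 _ hs).mem hu⟩,
        ⟨⟨hp, hu⟩, h4⟩, h5, h6⟩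
  have hw1 : (w 1).1 = {d} := by
    ext c
    rw [ZFSet.mem_singleton]
    refine ⟨fun hc => ?_, ?_⟩
    · have := (h1 ⟨c, (w 1).2.mem hc⟩).1 hc
      rw [← hw0, ← this]
    · rintro rfl
      exact (h1 ⟨c, hd⟩).2 (Subtype.ext hw0.symm)
  rw [← hw1]
  exact hw 1

/-! ### Countable ordinals -/

open Cardinal in
theorem mk_Iio_omega_one : #(Set.Iio (ω₁ : Ordinal.{0})) = ℵ₁ := by
  simp [Cardinal.mk_Iio_ordinal]

theorem countable_Iio {α : Ordinal.{0}} (hα : α < ω₁) : (Set.Iio α).Countable := by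
  rw [← Cardinal.le_aleph0_iff_set_countable, Cardinal.mk_Iio_ordinal]
  have : α.card < Cardinal.aleph 1 := by
    rw [← Cardinal.lt_ord]
    simpa using hα
  rw [← Cardinal.succ_aleph0, Order.lt_succ_iff] at this
  rw [← Cardinal.lift_aleph0.{1, 0}]
  exact Cardinal.lift_le.2 this

theorem add_one_lt_omega_one {α : Ordinal.{0}} (hα : α < ω₁) : α + 1 < ω₁ :=
  (Cardinal.isSuccLimit_omega 1).add_one_lt hα

theorem exists_lt_of_countable {S : Set Ordinal.{0}} (hS : S.Countable) (h : ∀ ξ ∈ S, ξ < ω₁) :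
    ∃ β < ω₁, ∀ ξ ∈ S, ξ < β := by
  have := hS.to_subtype
  refine ⟨(⨆ ξ : S, ξ.1) + 1, add_one_lt_omega_one
    (Ordinal.iSup_lt_omega_one fun ξ : S => h _ ξ.2), fun ξ hξ => ?_⟩
  exact Order.lt_add_one_iff.2 (Ordinal.le_iSup (fun ξ : S => ξ.1) ⟨ξ, hξ⟩)

/-- The sequence `a` is strictly increasing and cofinal in `α`. -/
structure IsLadder (a : ℕ → Ordinal.{0}) (α : Ordinal.{0}) : Prop where
  strictMono : StrictMono a
  lt : ∀ n, a n < α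
  exists_lt : ∀ ξ < α, ∃ n, ξ < a n

theorem exists_isLadder {α : Ordinal.{0}} (hα : α < ω₁) (hl : Order.IsSuccLimit α) :
    ∃ a, IsLadder a α := by
  obtain ⟨e, he⟩ := (countable_Iio hα).exists_eq_range ⟨0, hl.bot_lt⟩
  have hel : ∀ n, e n < α := fun n => (he ▸ ⟨n, rfl⟩ : e n ∈ Set.Iio α)
  -- Each `a n` exceeds `e n`, and `e` enumerates `α`, hence cofinality.
  let a : ℕ → Ordinal.{0} := fun n => Nat.rec (e 0 + 1) (fun n y => max (e (n + 1)) y + 1) n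
  have ha : ∀ n, a (n + 1) = max (e (n + 1)) (a n) + 1 := fun n => rfl
  refine ⟨a, strictMono_nat_of_lt_succ fun n => ?_, fun n => ?_, fun ξ hξ => ?_⟩
  · rw [ha]
    exact Order.lt_add_one_iff.2 (le_max_right _ _)
  · induction n with
    | zero => exact hl.add_one_lt (hel 0)
    | succ n ih => exact hl.add_one_lt (max_lt (hel _) ih)
  · obtain ⟨n, rfl⟩ : ξ ∈ Set.range e := he ▸ hξ
    refine ⟨n, ?_⟩
    cases n with
    | zero => exact Order.lt_add_one_iff.2 le_rfl
    | succ n => exact Order.lt_add_one_iff.2 (le_max_left _ _)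

/-- The limit ordinals closed under a function with values in `ω₁` form a club. -/
theorem isClub_closed {f : Ordinal.{0} → Ordinal.{0}} (hf : ∀ β < ω₁, f β < ω₁) :
    IsClub {α : Set.Iio (ω₁ : Ordinal.{0}) | Order.IsSuccLimit α.1 ∧ ∀ β < α.1, f β < α.1} := by
  have hlim : ∀ α : Ordinal.{0}, (0 < α ∧ ∀ β < α, β + 1 < α ∧ f β < α) →
      Order.IsSuccLimit α ∧ ∀ β < α, f β < α := by
    intro α h
    refine ⟨?_, fun β hβ => (h.2 β hβ).2⟩
    rw [Order.isSuccLimit_iff, Order.isSuccPrelimit_iff_succ_lt]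
    exact ⟨by simpa [isMin_iff_eq_bot, ← pos_iff_ne_zero] using h.1,
      fun β hβ => by simpa using (h.2 β hβ).1⟩
  constructor
  · intro d hd hne _ α hα
    have hlt : ∀ β < α.1, ∃ γ ∈ d, β < γ.1 := by
      intro β hβ
      have : ¬ (⟨β, hβ.trans α.2⟩ : Set.Iio (ω₁ : Ordinal.{0})) ∈ upperBounds d := fun h =>
        absurd (hα.2 h) (not_le.2 hβ)
      simp only [upperBounds, Set.mem_ofPred_eq, not_forall, not_le] at this
      obtain ⟨γ, hγ, h⟩ := this
      exact ⟨γ, hγ, h⟩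
    refine hlim α ⟨?_, fun β hβ => ?_⟩
    · obtain ⟨γ, hγ⟩ := hne
      exact (hd hγ).1.bot_lt.trans_le (hα.1 hγ)
    · obtain ⟨γ, hγ, h⟩ := hlt β hβ
      exact ⟨((hd hγ).1.add_one_lt h).trans_le (hα.1 hγ), ((hd hγ).2 β h).trans_le (hα.1 hγ)⟩
  · intro β₀
    have hg : ∀ γ : Ordinal.{0}, γ < ω₁ → ∃ δ < ω₁, γ + 1 < δ ∧ ∀ β < γ, f β < δ := by
      intro γ hγ
      obtain ⟨δ, hδ, h⟩ := exists_lt_of_countable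
        (((countable_Iio hγ).image f).insert (γ + 1)) (by
          rintro ξ (rfl | ⟨β, hβ, rfl⟩)
          · exact add_one_lt_omega_one hγ
          · exact hf β (lt_trans hβ hγ))
      exact ⟨δ, hδ, h _ (Set.mem_insert _ _), fun β hβ => h _ (Or.inr ⟨β, hβ, rfl⟩)⟩
    choose! g hg1 hg2 hg3 using hg
    -- As `g γ` bounds `f` on `γ`, the supremum of the iterates of `g` is closed under `f`.
    let a : ℕ → Ordinal.{0} := fun n => g^[n] β₀.1
    have ha : ∀ n, a (n + 1) = g (a n) := fun n => Function.iterate_succ_apply' _ _ _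
    have hal : ∀ n, a n < ω₁ := by
      intro n
      induction n with
      | zero => exact β₀.2
      | succ n ih => rw [ha]; exact hg1 _ ih
    have hle : ∀ n, a n ≤ ⨆ n, a n := Ordinal.le_iSup a
    refine ⟨⟨⨆ n, a n, Ordinal.iSup_lt_omega_one hal⟩, hlim _ ⟨?_, fun β hβ => ?_⟩, hle 0⟩
    · have := hg2 _ (hal 0)
      rw [← ha] at this
      exact bot_le.trans_lt (this.trans_le (hle 1))
    · obtain ⟨n, hn⟩ := (Ordinal.lt_iSup_iff).1 hβ
      have h1 := hg2 _ (hal n)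
      rw [← ha] at h1
      have h2 := hg3 _ (hal n) β hn
      rw [← ha] at h2
      refine ⟨lt_of_le_of_lt ?_ (h1.trans_le (hle _)), h2.trans_le (hle _)⟩
      gcongr

/-! ### Codes for finite objects -/

/-- Finite sets of ordinals and finite sequences of pairs of an ordinal and a finite set. -/
abbrev Datum := Finset Ordinal.{0} ⊕ List (Ordinal.{0} × Finset Ordinal.{0})

/-- The ordinals that occur in a datum. -/
noncomputable def Datum.supp : Datum → Finset Ordinal.{0}
  | .inl F => F
  | .inr l => l.toFinset.biUnion fun p => insert p.1 p.2

/-- The datum obtained from a datum whose entries are elements of `S`. -/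
def Datum.ofSubtype (S : Set Ordinal.{0}) : Finset S ⊕ List (S × Finset S) → Datum :=
  Sum.map (Finset.map (Function.Embedding.subtype (· ∈ S)))
    (List.map (Prod.map Subtype.val (Finset.map (Function.Embedding.subtype (· ∈ S)))))

theorem mem_range_of_supp_subset {S : Set Ordinal.{0}} {z : Datum} (h : ∀ ξ ∈ z.supp, ξ ∈ S) :
    z ∈ Set.range (Datum.ofSubtype S) := by
  classical
  cases z with
  | inl F => exact ⟨.inl (F.subtype (· ∈ S)), congrArg Sum.inl (Finset.subtype_map_of_mem h)⟩
  | inr l =>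
    have h' : ∀ p ∈ l, p.1 ∈ S ∧ ∀ ξ ∈ p.2, ξ ∈ S := by
      intro p hp
      have hsub : ∀ ξ ∈ insert p.1 p.2, ξ ∈ S := fun ξ hξ =>
        h ξ (Finset.mem_biUnion.2 ⟨p, List.mem_toFinset.2 hp, hξ⟩)
      exact ⟨hsub _ (Finset.mem_insert_self _ _), fun ξ hξ => hsub _ (Finset.mem_insert_of_mem hξ)⟩
    have hl : l ∈ Set.range (List.map (Prod.map (Subtype.val : S → Ordinal.{0})
        (Finset.map (Function.Embedding.subtype (· ∈ S))))) := by
      rw [Set.range_list_map]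
      intro p hp
      exact ⟨(⟨p.1, (h' p hp).1⟩, p.2.subtype (· ∈ S)),
        Prod.ext rfl (Finset.subtype_map_of_mem (h' p hp).2)⟩
    obtain ⟨l', rfl⟩ := hl
    exact ⟨.inr l', rfl⟩

theorem countable_supp_subset {S : Set Ordinal.{0}} (hS : S.Countable) :
    {z : Datum | ∀ ξ ∈ z.supp, ξ ∈ S}.Countable := by
  have := hS.to_subtype
  exact (Set.countable_range _).mono fun z hz => mem_range_of_supp_subset hz

open Cardinal in
/-- An injective coding of the data on countable ordinals by countable ordinals. -/
theorem exists_code : ∃ c : Datum → Ordinal.{0},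
    Set.InjOn c {z | ∀ ξ ∈ z.supp, ξ < ω₁} ∧ ∀ z, (∀ ξ ∈ z.supp, ξ < ω₁) → c z < ω₁ := by
  let X : Set Datum := {z | ∀ ξ ∈ z.supp, ξ ∈ Set.Iio (ω₁ : Ordinal.{0})}
  have hX : #X ≤ #(Set.Iio (ω₁ : Ordinal.{0})) := by
    have hinf : Infinite (Set.Iio (ω₁ : Ordinal.{0})) := by
      rw [infinite_iff, mk_Iio_omega_one]
      exact aleph0_le_aleph 1
    refine (mk_le_mk_of_subset fun z hz => mem_range_of_supp_subset hz).trans (mk_range_le.trans ?_)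
    simp
  obtain ⟨e⟩ := hX
  classical
  refine ⟨fun z => if hz : z ∈ X then e ⟨z, hz⟩ else 0, fun z hz w hw h => ?_, fun z hz => ?_⟩
  · have hz' : z ∈ X := hz
    have hw' : w ∈ X := hw
    simp only [hz', hw', dif_pos] at h
    exact congrArg Subtype.val (e.injective (Subtype.ext h))
  · have hz' : z ∈ X := hz
    simp only [hz', dif_pos]
    exact (e ⟨z, hz'⟩).2

/-! ### Coherent sequences and their trees -/

/-- The values of `f` are switched on the finite set `F`. -/
noncomputable def switch (f : Ordinal.{0} → Bool) (F : Finset Ordinal.{0}) (ξ : Ordinal.{0}) : Bool :=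
  f ξ ^^ decide (ξ ∈ F)

/-- The index of the interval of the sequence `a` that contains `ξ`. -/
noncomputable def piece (a : ℕ → Ordinal.{0}) (ξ : Ordinal.{0}) : ℕ := sInf {n | ξ < a n}

theorem lt_piece {a : ℕ → Ordinal.{0}} {ξ : Ordinal.{0}} {n : ℕ} (h : ξ < a n) :
    ξ < a (piece a ξ) := Nat.sInf_mem (s := {n | ξ < a n}) ⟨n, h⟩

theorem piece_le {a : ℕ → Ordinal.{0}} {ξ : Ordinal.{0}} {n : ℕ} (h : ξ < a n) :
    piece a ξ ≤ n := Nat.sInf_le h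

/-- On the `n`-th interval of `a`, the function `x (a n)` switched on the finite set `Φ n`. -/
noncomputable def glue (x : Ordinal.{0} → Ordinal.{0} → Bool) (a : ℕ → Ordinal.{0})
    (Φ : ℕ → Finset Ordinal.{0}) (ξ : Ordinal.{0}) : Bool :=
  switch (x (a (piece a ξ))) (Φ (piece a ξ)) ξ

theorem piece_congr {a a' : ℕ → Ordinal.{0}} {m : ℕ} (h : ∀ n ≤ m, a n = a' n) {ξ : Ordinal.{0}}
    (hξ : ξ < a m) : piece a ξ = piece a' ξ := by
  have hξ' : ξ < a' m := h m le_rfl ▸ hξ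
  refine le_antisymm (piece_le ?_) (piece_le ?_)
  · rw [h _ (piece_le hξ')]; exact lt_piece hξ'
  · rw [← h _ (piece_le hξ)]; exact lt_piece hξ

/-- Below `a m` only the first `m + 1` rungs and finite sets are consulted; this is why a finite
list can describe a node. -/
theorem glue_congr {x : Ordinal.{0} → Ordinal.{0} → Bool} {a a' : ℕ → Ordinal.{0}}
    {Φ Φ' : ℕ → Finset Ordinal.{0}} {m : ℕ} (h : ∀ n ≤ m, a n = a' n) (h' : ∀ n ≤ m, Φ n = Φ' n)
    {ξ : Ordinal.{0}} (hξ : ξ < a m) : glue x a Φ ξ = glue x a' Φ' ξ := by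
  rw [glue, glue, ← piece_congr h hξ, h _ (piece_le hξ), h' _ (piece_le hξ)]

/-- Recursion on `α`: the rungs lie below `α`, so gluing only calls earlier functions. Values of `x
α` outside `α` are irrelevant defaults. -/
theorem exists_glued (a : Ordinal.{0} → ℕ → Ordinal.{0}) (Φ : Ordinal.{0} → ℕ → Finset Ordinal.{0})
    (ha : ∀ α < ω₁, Order.IsSuccLimit α → IsLadder (a α) α) :
    ∃ x : Ordinal.{0} → Ordinal.{0} → Bool, (∀ α, ∀ ξ < α, x (α + 1) ξ = x α ξ) ∧
      ∀ α < ω₁, Order.IsSuccLimit α → x α = glue x (a α) (Φ α) := by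
  classical
  let x : Ordinal.{0} → Ordinal.{0} → Bool := fun α =>
    Ordinal.limitRecOn α (fun _ => false) (fun _ f => f) fun α _ f =>
      glue (fun γ => if h : γ < α then f γ h else fun _ => false) (a α) (Φ α)
  refine ⟨x, fun α ξ _ => ?_, fun α hα hl => ?_⟩
  · simp only [x, Ordinal.limitRecOn_add_one]
  · funext ξ
    simp only [x]
    rw [Ordinal.limitRecOn_limit _ _ _ _ hl]
    simp only [glue, switch, (ha α hα hl).lt, dif_pos]

/-- The functions `x α` and `x β` agree on `α ∩ β` up to finitely many arguments. -/
def Coherent (x : Ordinal.{0} → Ordinal.{0} → Bool) : Prop :=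
  ∀ α < ω₁, ∀ β ≤ α, {ξ | ξ < β ∧ x β ξ ≠ x α ξ}.Finite

theorem finite_switch_ne (f : Ordinal.{0} → Bool) (F : Finset Ordinal.{0}) :
    {ξ | switch f F ξ ≠ f ξ}.Finite :=
  F.finite_toSet.subset fun ξ hξ => by
    by_contra h
    simp [switch, show ξ ∉ F from h] at hξ

/-- Below `a m` there are finitely many intervals, and on each of them coherence and the finite
switch leave finitely many disagreements. Coherence is assumed only below `δ`, so that the lemma
applies inside the induction that proves coherence. -/
theorem Coherent.finite_glue_ne {x : Ordinal.{0} → Ordinal.{0} → Bool} {δ : Ordinal.{0}}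
    (hx : ∀ α < δ, ∀ β ≤ α, {ξ | ξ < β ∧ x β ξ ≠ x α ξ}.Finite) {a : ℕ → Ordinal.{0}}
    (ha : ∀ n, a n < δ) (Φ : ℕ → Finset Ordinal.{0}) {β : Ordinal.{0}} {m : ℕ}
    (hβ : β ≤ a m) : {ξ | ξ < β ∧ x β ξ ≠ glue x a Φ ξ}.Finite := by
  have key : ∀ α < δ, {ξ | ξ < β ∧ ξ < α ∧ x β ξ ≠ x α ξ}.Finite := by
    intro α hα
    rcases le_total β α with h | h
    · exact (hx α hα β h).subset fun ξ hξ => ⟨hξ.1, hξ.2.2⟩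
    · exact (hx β (hβ.trans_lt (ha m)) α h).subset fun ξ hξ => ⟨hξ.2.1, hξ.2.2.symm⟩
  refine (((Set.finite_Iic m).biUnion fun n _ => key (a n) (ha n)).union
    ((Set.finite_Iic m).biUnion fun n _ => finite_switch_ne (x (a n)) (Φ n))).subset ?_
  rintro ξ ⟨h1, h2⟩
  have h3 := h1.trans_le hβ
  by_cases h : x β ξ = x (a (piece a ξ)) ξ
  · exact Or.inr (Set.mem_biUnion (x := piece a ξ) (piece_le h3) fun h4 => h2 (h.trans h4.symm))
  · exact Or.inl (Set.mem_biUnion (x := piece a ξ) (piece_le h3) ⟨h1, lt_piece h3, h⟩)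

theorem coherent_of_glued {a : Ordinal.{0} → ℕ → Ordinal.{0}}
    {Φ : Ordinal.{0} → ℕ → Finset Ordinal.{0}}
    (ha : ∀ α < ω₁, Order.IsSuccLimit α → IsLadder (a α) α)
    {x : Ordinal.{0} → Ordinal.{0} → Bool} (hs : ∀ α, ∀ ξ < α, x (α + 1) ξ = x α ξ)
    (hl : ∀ α < ω₁, Order.IsSuccLimit α → x α = glue x (a α) (Φ α)) : Coherent x := by
  intro α
  induction α using WellFoundedLT.induction with
  | _ α ih =>
  intro hα β hβ
  rcases hβ.eq_or_lt with rfl | hβ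
  · simp
  rcases Order.isMin_or_mem_range_succ_or_isSuccLimit α with h0 | ⟨γ, rfl⟩ | hlim
  · exact absurd hβ h0.not_lt
  · have hβγ : β ≤ γ := Order.lt_succ_iff.1 hβ
    have hγ : γ < Order.succ γ := Order.lt_succ γ
    refine (ih γ hγ (hγ.trans hα) β hβγ).subset fun ξ hξ => ⟨hξ.1, fun h => hξ.2 ?_⟩
    rw [h, Order.succ_eq_add_one, hs γ ξ (hξ.1.trans_le hβγ)]
  · rw [hl α hα hlim]
    obtain ⟨m, hm⟩ := (ha α hα hlim).exists_lt β hβ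
    exact Coherent.finite_glue_ne (fun γ hγ => ih γ hγ (hγ.trans hα)) (ha α hα hlim).lt _ hm.le

/-! ### The tree of finite modifications -/

/-- The function on all ordinals that extends `t` by `false`. -/
noncomputable def BinSeq.toFun (t : BinSeq) (ξ : Ordinal.{0}) : Bool :=
  open Classical in if h : ξ < t.len then t.val ⟨ξ, h⟩ else false

theorem BinSeq.toFun_of_lt (t : BinSeq) {ξ : Ordinal.{0}} (h : ξ < t.len) :
    t.toFun ξ = t.val ⟨ξ, h⟩ := dif_pos h

/-- The restriction of `f` to `α`. -/
def BinSeq.ofFun (α : Ordinal.{0}) (hα : α < ω₁) (f : Ordinal.{0} → Bool) : BinSeq :=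
  ⟨α, hα, fun ξ => f ξ⟩

theorem BinSeq.toFun_ofFun {α : Ordinal.{0}} (hα : α < ω₁) (f : Ordinal.{0} → Bool)
    {ξ : Ordinal.{0}} (h : ξ < α) : (BinSeq.ofFun α hα f).toFun ξ = f ξ :=
  (BinSeq.ofFun α hα f).toFun_of_lt h

theorem isInit_iff {s t : BinSeq} :
    IsInit s t ↔ s.len ≤ t.len ∧ ∀ ξ < s.len, s.toFun ξ = t.toFun ξ := by
  constructor
  · rintro ⟨h, h'⟩
    refine ⟨h, fun ξ hξ => ?_⟩
    rw [s.toFun_of_lt hξ, t.toFun_of_lt (hξ.trans_le h)]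
    exact h' ⟨ξ, hξ⟩
  · rintro ⟨h, h'⟩
    refine ⟨h, fun ξ => ?_⟩
    have := h' ξ ξ.2
    rwa [s.toFun_of_lt ξ.2, t.toFun_of_lt (lt_of_lt_of_le ξ.2 h)] at this

theorem BinSeq.ext_toFun {s t : BinSeq} (h : s.len = t.len)
    (h' : ∀ ξ < s.len, s.toFun ξ = t.toFun ξ) : s = t := by
  obtain ⟨α, hα, f⟩ := s
  obtain ⟨β, hβ, g⟩ := t
  obtain rfl : α = β := h
  congr 1
  funext ξ
  have := h' ξ ξ.2
  rwa [BinSeq.toFun_of_lt _ ξ.2, BinSeq.toFun_of_lt _ ξ.2] at this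

/-- The finite modifications of the functions `x α` restricted to `α`. -/
def tree (x : Ordinal.{0} → Ordinal.{0} → Bool) : Set BinSeq :=
  {t | {ξ | ξ < t.len ∧ t.toFun ξ ≠ x t.len ξ}.Finite}

theorem finite_ne_trans {α : Ordinal.{0}} {f g h : Ordinal.{0} → Bool}
    (h1 : {ξ | ξ < α ∧ f ξ ≠ g ξ}.Finite) (h2 : {ξ | ξ < α ∧ g ξ ≠ h ξ}.Finite) :
    {ξ | ξ < α ∧ f ξ ≠ h ξ}.Finite :=
  (h1.union h2).subset fun ξ hξ => by
    by_cases hfg : f ξ = g ξ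
    · exact Or.inr ⟨hξ.1, hfg ▸ hξ.2⟩
    · exact Or.inl ⟨hξ.1, hfg⟩

theorem finite_ne_symm {α : Ordinal.{0}} {f g : Ordinal.{0} → Bool}
    (h : {ξ | ξ < α ∧ f ξ ≠ g ξ}.Finite) : {ξ | ξ < α ∧ g ξ ≠ f ξ}.Finite :=
  h.subset fun _ hξ => ⟨hξ.1, hξ.2.symm⟩

theorem finite_ne_mono {α β : Ordinal.{0}} (hβ : β ≤ α) {f g : Ordinal.{0} → Bool}
    (h : {ξ | ξ < α ∧ f ξ ≠ g ξ}.Finite) : {ξ | ξ < β ∧ f ξ ≠ g ξ}.Finite :=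
  h.subset fun _ hξ => ⟨hξ.1.trans_le hβ, hξ.2⟩

theorem ofFun_mem_tree {x : Ordinal.{0} → Ordinal.{0} → Bool} {α : Ordinal.{0}} (hα : α < ω₁)
    {f : Ordinal.{0} → Bool} (h : {ξ | ξ < α ∧ f ξ ≠ x α ξ}.Finite) :
    BinSeq.ofFun α hα f ∈ tree x :=
  h.subset fun _ hξ => ⟨hξ.1, fun h' => hξ.2 ((BinSeq.toFun_ofFun hα f hξ.1).trans h')⟩

theorem Coherent.mem_tree {x : Ordinal.{0} → Ordinal.{0} → Bool} (hx : Coherent x) {s t : BinSeq}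
    (ht : t ∈ tree x) (h : IsInit s t) : s ∈ tree x := by
  obtain ⟨h1, h2⟩ := isInit_iff.1 h
  have h3 := finite_ne_trans (finite_ne_mono h1 ht) (finite_ne_symm (hx t.len t.len_lt s.len h1))
  exact h3.subset fun ξ hξ => ⟨hξ.1, h2 ξ hξ.1 ▸ hξ.2⟩

theorem isTree_tree {x : Ordinal.{0} → Ordinal.{0} → Bool} (hx : Coherent x) : IsTree (tree x) :=
  ⟨⟨BinSeq.ofFun 0 (Ordinal.omega_pos 1) (x 0), ofFun_mem_tree _ (by simp)⟩,
    fun _ ht _ hs => hx.mem_tree ht hs⟩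

theorem level_tree_nonempty (x : Ordinal.{0} → Ordinal.{0} → Bool) {α : Ordinal.{0}} (hα : α < ω₁) :
    (level (tree x) α).Nonempty :=
  ⟨BinSeq.ofFun α hα (x α), ofFun_mem_tree _ (by simp), rfl⟩

theorem exists_switch_of_mem_level {x : Ordinal.{0} → Ordinal.{0} → Bool} {t : BinSeq}
    (ht : t ∈ tree x) : ∃ F : Finset Ordinal.{0}, (∀ ξ ∈ F, ξ < t.len) ∧
      ∀ ξ < t.len, t.toFun ξ = switch (x t.len) F ξ := by
  have ht' : {ξ | ξ < t.len ∧ t.toFun ξ ≠ x t.len ξ}.Finite := ht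
  refine ⟨ht'.toFinset, fun ξ hξ => (ht'.mem_toFinset.1 hξ).1,
    fun ξ hξ => ?_⟩
  have hmem : ξ ∈ ht'.toFinset ↔ t.toFun ξ ≠ x t.len ξ := by
    rw [Set.Finite.mem_toFinset]
    exact and_iff_right hξ
  have hxor : ∀ b c : Bool, b = (c ^^ decide (b ≠ c)) := by decide
  rw [switch, decide_eq_decide.2 hmem]
  exact hxor _ _

theorem countable_level_tree (x : Ordinal.{0} → Ordinal.{0} → Bool) {α : Ordinal.{0}}
    (hα : α < ω₁) : (level (tree x) α).Countable := by
  refine ((Set.countable_ofPred_finite_subset (countable_Iio hα)).image fun S : Set Ordinal.{0} =>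
    open Classical in BinSeq.ofFun α hα fun ξ => x α ξ ^^ decide (ξ ∈ S)).mono ?_
  rintro t ⟨ht, rfl⟩
  obtain ⟨F, hF, h⟩ := exists_switch_of_mem_level ht
  refine ⟨F, ⟨F.finite_toSet, hF⟩, BinSeq.ext_toFun rfl fun ξ hξ => ?_⟩
  rw [h ξ hξ, switch]
  exact (BinSeq.toFun_ofFun _ _ hξ).trans (by simp)

theorem countable_of_len_lt {x : Ordinal.{0} → Ordinal.{0} → Bool} {α : Ordinal.{0}}
    (hα : α < ω₁) {C : Set BinSeq} (hC : C ⊆ tree x) (h : ∀ t ∈ C, t.len < α) : C.Countable := by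
  refine ((countable_Iio hα).biUnion fun β hβ =>
    countable_level_tree x (lt_trans hβ hα)).mono fun t ht => ?_
  exact Set.mem_biUnion (x := t.len) (h t ht) ⟨hC ht, rfl⟩

/-! ### Dense open subsets of the tree -/

/-- `E` is a dense subset of the tree `T` that is closed under end-extensions. -/
structure IsDenseOpen (T E : Set BinSeq) : Prop where
  subset : E ⊆ T
  dense : ∀ t ∈ T, ∃ t' ∈ E, IsInit t t'
  isOpen : ∀ t ∈ E, ∀ t' ∈ T, IsInit t t' → t' ∈ E

theorem IsInit.refl (t : BinSeq) : IsInit t t := ⟨le_rfl, fun _ => rfl⟩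

theorem IsInit.trans {s t u : BinSeq} (h1 : IsInit s t) (h2 : IsInit t u) : IsInit s u := by
  rw [isInit_iff] at *
  exact ⟨h1.1.trans h2.1, fun ξ hξ => (h1.2 ξ hξ).trans (h2.2 ξ (hξ.trans_le h1.1))⟩

theorem IsInit.total {s t u : BinSeq} (h1 : IsInit s u) (h2 : IsInit t u) :
    IsInit s t ∨ IsInit t s := by
  simp only [isInit_iff] at *
  rcases le_total s.len t.len with h | h
  · exact Or.inl ⟨h, fun ξ hξ => (h1.2 ξ hξ).trans (h2.2 ξ (hξ.trans_le h)).symm⟩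
  · exact Or.inr ⟨h, fun ξ hξ => (h2.2 ξ hξ).trans (h1.2 ξ (hξ.trans_le h)).symm⟩

theorem exists_isInit_len {t : BinSeq} {α : Ordinal.{0}} (h : α ≤ t.len) :
    ∃ s, s.len = α ∧ IsInit s t :=
  ⟨BinSeq.ofFun α (h.trans_lt t.len_lt) t.toFun, rfl,
    isInit_iff.2 ⟨h, fun _ hξ => BinSeq.toFun_ofFun _ _ hξ⟩⟩

/-- A tree of finite modifications of a coherent sequence is a Suslin tree if each of its dense
open subsets contains a level. -/
theorem isSuslinTree_tree {x : Ordinal.{0} → Ordinal.{0} → Bool} (hx : Coherent x)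
    (h : ∀ E, IsDenseOpen (tree x) E → ∃ α < ω₁, level (tree x) α ⊆ E) :
    IsSuslinTree (tree x) where
  isTree := isTree_tree hx
  height _ hα := level_tree_nonempty x hα
  countable_chain C hC hch := by
    obtain ⟨α, hα, hE⟩ | hbdd : (∃ α < ω₁, ∀ t ∈ C, t.len < α) ∨
        ∀ α < ω₁, ∃ t ∈ C, α ≤ t.len := by
      by_contra! hc
      obtain ⟨α, hα, h1⟩ := hc.2
      obtain ⟨t, ht, h2⟩ := hc.1 α hα
      exact absurd (h1 t ht) (not_lt.2 h2)
    · exact countable_of_len_lt hα hC hE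
    exfalso
    -- In an unbounded chain there is a `c` longer than `t`; extending `t` by one value that differs
    -- from `c` makes it incomparable with `c`, whence density.
    obtain ⟨α, hα, hE⟩ := h {t ∈ tree x | ∃ c ∈ C, ¬ IsInit t c ∧ ¬ IsInit c t} ⟨fun t ht => ht.1,
      fun t ht => by
        obtain ⟨c, hc, hlen⟩ := hbdd (t.len + 1) (add_one_lt_omega_one t.len_lt)
        have hlt : t.len < t.len + 1 := Order.lt_add_one_iff.2 le_rfl
        let f : Ordinal.{0} → Bool := fun ξ => if ξ = t.len then !(c.toFun ξ) else t.toFun ξ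
        have hf : ∀ ξ < t.len, f ξ = t.toFun ξ := fun ξ hξ => if_neg hξ.ne
        have hfin : {ξ | ξ < t.len + 1 ∧ f ξ ≠ x (t.len + 1) ξ}.Finite := by
          refine ((finite_ne_trans ht (hx _ (add_one_lt_omega_one t.len_lt) t.len hlt.le)).insert
            t.len).subset fun ξ hξ => ?_
          rcases (Order.lt_add_one_iff.1 hξ.1).eq_or_lt with h1 | h1
          · exact Or.inl h1
          · exact Or.inr ⟨h1, hf ξ h1 ▸ hξ.2⟩
        let u := BinSeq.ofFun (t.len + 1) (add_one_lt_omega_one t.len_lt) f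
        have hu : u.toFun t.len ≠ c.toFun t.len := by
          rw [BinSeq.toFun_ofFun _ _ hlt]
          simp [f]
        refine ⟨u, ⟨ofFun_mem_tree _ hfin, c, hc, fun h1 => hu ((isInit_iff.1 h1).2 _ hlt),
          fun h1 => hu ((isInit_iff.1 h1).2 _ (hlt.trans_le hlen)).symm⟩, isInit_iff.2 ⟨hlt.le,
          fun ξ hξ => ?_⟩⟩
        rw [BinSeq.toFun_ofFun _ _ (hξ.trans hlt), hf ξ hξ],
      fun t ht t' ht' hi => by
        obtain ⟨-, c, hc, h1, h2⟩ := ht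
        exact ⟨ht', c, hc, fun h3 => h1 (hi.trans h3), fun h3 => (hi.total h3).elim h1 h2⟩⟩
    -- The restriction to `α` of a long member of the chain is comparable with the whole chain, so
    -- level `α` is not contained in the dense open set.
    obtain ⟨t, ht, hlen⟩ := hbdd α hα
    obtain ⟨s, hs, hst⟩ := exists_isInit_len hlen
    obtain ⟨-, c, hc, h1, h2⟩ := hE ⟨hx.mem_tree (hC ht) hst, hs⟩
    rcases hch t ht c hc with h3 | h3
    · exact h1 (hst.trans h3)
    · exact (hst.total h3).elim h1 h2
  countable_antichain C hC hanti := by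
    -- A level inside this set bounds the antichain: a longer member `t` would have its restriction
    -- to that level either above another member or below none, although it is below `t`.
    obtain ⟨α, hα, hE⟩ := h {t ∈ tree x | (∃ c ∈ C, IsInit c t) ∨ ∀ c ∈ C, ¬ IsInit t c}
      ⟨fun t ht => ht.1, fun t ht => by
        by_cases hc : ∃ c ∈ C, IsInit t c
        · obtain ⟨c, hc, hi⟩ := hc
          exact ⟨c, ⟨hC hc, Or.inl ⟨c, hc, .refl c⟩⟩, hi⟩
        · push Not at hc
          exact ⟨t, ⟨ht, Or.inr hc⟩, .refl t⟩,
      fun t ht t' ht' hi => ⟨ht', ht.2.imp (fun ⟨c, hc, h1⟩ => ⟨c, hc, h1.trans hi⟩)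
        fun h1 c hc h2 => h1 c hc (hi.trans h2)⟩⟩
    refine countable_of_len_lt (add_one_lt_omega_one hα) hC fun t ht => ?_
    by_contra hlen
    have hlen : α < t.len := lt_of_lt_of_le (Order.lt_add_one_iff.2 le_rfl) (not_lt.1 hlen)
    obtain ⟨s, hs, hst⟩ := exists_isInit_len hlen.le
    rcases (hE ⟨hx.mem_tree (hC ht) hst, hs⟩).2 with ⟨c, hc, h1⟩ | h1
    · have hne : c ≠ t := by
        rintro rfl
        exact absurd (isInit_iff.1 h1).1 (not_le.2 (hs ▸ hlen))
      exact (hanti c hc t ht hne).1 (h1.trans hst)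
    · exact h1 t ht hst

/-! ### Reals as sequences of finite sets -/

/-- The place of the first `1` in the `n`-th row of `y`. -/
noncomputable def rowIdx (y : ℕ → Bool) (n : ℕ) : ℕ := sInf {j | y (Nat.pair n j) = true}

/-- The first `k` values of `y` contain a `1` in each of the rows `0, …, m`. -/
def Decides (y : ℕ → Bool) (k m : ℕ) : Prop := ∀ n ≤ m, ∃ j, Nat.pair n j < k ∧ y (Nat.pair n j) = true

theorem rowIdx_eq {y : ℕ → Bool} {n j : ℕ} (h : y (Nat.pair n j) = true)
    (h' : ∀ i < j, y (Nat.pair n i) = false) : rowIdx y n = j := by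
  refine le_antisymm (Nat.sInf_le h) (le_csInf ⟨j, h⟩ fun i hi => ?_)
  by_contra hij
  simp [h' i (not_le.1 hij)] at hi

/-- Positions increase along a row, so all entries up to a `1` at a position below `k` also lie
below `k`. -/
theorem Decides.rowIdx_congr {y y' : ℕ → Bool} {k m n : ℕ} (h : Decides y k m)
    (hy : ∀ i < k, y' i = y i) (hn : n ≤ m) : rowIdx y' n = rowIdx y n := by
  obtain ⟨j, hj, h1⟩ := h n hn
  have hle : rowIdx y n ≤ j := Nat.sInf_le h1
  have hmem : y (Nat.pair n (rowIdx y n)) = true :=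
    Nat.sInf_mem (s := {j | y (Nat.pair n j) = true}) ⟨j, h1⟩
  have hlt : ∀ i ≤ j, Nat.pair n i < k := fun i hi =>
    lt_of_le_of_lt (hi.eq_or_lt.elim (fun h => h ▸ le_rfl) fun h =>
      (Nat.pair_lt_pair_right n h).le) hj
  refine rowIdx_eq ((hy _ (hlt _ hle)).trans hmem) fun i hi => ?_
  rw [hy _ (hlt i (hi.le.trans hle)), ← Bool.not_eq_true]
  exact Nat.notMem_of_lt_sInf (s := {j | y (Nat.pair n j) = true}) hi

/-- The first rows that meet `{0, …, k - 1}` may be completed in a fixed way, the other ones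
arbitrarily. -/
theorem exists_decides (y : ℕ → Bool) (k : ℕ) : ∃ d : ℕ → ℕ, ∀ (c : ℕ → ℕ) (m : ℕ),
    ∃ (y' : ℕ → Bool) (k' : ℕ), k ≤ k' ∧ (∀ i < k, y' i = y i) ∧ Decides y' k' m ∧
      (∀ n < k, rowIdx y' n = d n) ∧ ∀ n, k ≤ n → rowIdx y' n = c n := by
  -- Since `n ≤ Nat.pair n j`, the rows from `k` on are untouched by the first `k` values and can
  -- have their only `1` at `c n`. Rows before `k` are filled with `1` beyond the given part,
  -- independently of `c`.
  let e : (ℕ → ℕ) → ℕ → Bool := fun c z =>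
    if z < k then y z else if z.unpair.1 < k then true else decide (z.unpair.2 = c z.unpair.1)
  have he : ∀ c n j, n < k → e c (Nat.pair n j) = if Nat.pair n j < k then y (Nat.pair n j) else true := by
    intro c n j hn
    simp only [e, Nat.unpair_pair, hn, if_true]
  have he' : ∀ c n j, k ≤ n → e c (Nat.pair n j) = decide (j = c n) := by
    intro c n j hn
    have h1 : ¬ Nat.pair n j < k := not_lt.2 (hn.trans (Nat.left_le_pair n j))
    simp only [e, Nat.unpair_pair, not_lt.2 hn, h1, if_false]
  -- The new length exceeds a sure `1` in every row up to `m`: at place `c n` if `k ≤ n`, and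
  -- otherwise at place `k`, since `k ≤ Nat.pair n k`.
  refine ⟨rowIdx (e 0), fun c m => ⟨e c, k + ∑ n ∈ Finset.range (m + 1),
    (Nat.pair n (if n < k then k else c n) + 1), Nat.le_add_right _ _,
    fun i hi => if_pos hi, fun n hn => ⟨if n < k then k else c n, ?_, ?_⟩, fun n hn => ?_,
    fun n hn => ?_⟩⟩
  · have := Finset.single_le_sum (f := fun n => Nat.pair n (if n < k then k else c n) + 1)
      (fun _ _ => Nat.zero_le _) (Finset.mem_range.2 (show n < m + 1 by omega))
    omega
  · split_ifs with h
    · rw [he c n k h, if_neg (not_lt.2 (Nat.right_le_pair n k))]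
    · simp [he' c n _ (not_lt.1 h)]
  · simp only [rowIdx, he _ n _ hn]
  · refine rowIdx_eq (by simp [he' c n _ hn]) fun i hi => ?_
    simp [he' c n i hn, hi.ne]

/-- Some element of `E` is the restriction of `f` to `α`. -/
def Passes (E : Set BinSeq) (α : Ordinal.{0}) (f : Ordinal.{0} → Bool) : Prop :=
  ∃ t ∈ E, t.len = α ∧ ∀ ξ < α, t.toFun ξ = f ξ

theorem Passes.congr {E : Set BinSeq} {α : Ordinal.{0}} {f g : Ordinal.{0} → Bool}
    (h : Passes E α f) (hfg : ∀ ξ < α, f ξ = g ξ) : Passes E α g := by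
  obtain ⟨t, ht, hlen, hf⟩ := h
  exact ⟨t, ht, hlen, fun ξ hξ => (hf ξ hξ).trans (hfg ξ hξ)⟩

/-- Every finite sequence can be extended such that the branch below the limit `α` that it
approximates meets `E`. -/
theorem exists_decides_passes {x : Ordinal.{0} → Ordinal.{0} → Bool} (hx : Coherent x)
    {α : Ordinal.{0}} (hα : α < ω₁) {a : ℕ → Ordinal.{0}} (ha : IsLadder a α)
    {dec : ℕ → Finset Ordinal.{0}} (hdec : ∀ F : Finset Ordinal.{0}, (∀ ξ ∈ F, ξ < α) → ∃ j, dec j = F)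
    {E : Set BinSeq} (hE : IsDenseOpen (tree x) E)
    (hcl : ∀ t ∈ tree x, t.len < α → ∃ t' ∈ E, IsInit t t' ∧ t'.len < α)
    (F : Finset Ordinal.{0}) (y : ℕ → Bool) (k : ℕ) :
    ∃ (y' : ℕ → Bool) (k' m : ℕ), k ≤ k' ∧ (∀ i < k, y' i = y i) ∧ Decides y' k' m ∧
      Passes E (a m) (switch (glue x a fun n => dec (rowIdx y' n)) F) := by
  obtain ⟨d, hd⟩ := exists_decides y k
  have hlt : ∀ n, a n < ω₁ := fun n => (ha.lt n).trans hα
  -- The rows before `k` are completed in the fixed way `d`, and row `k` gets the arbitrary value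
  -- `0`; this fixes the branch below `a k` before its extension into `E` is chosen.
  let Φ₀ : ℕ → Finset Ordinal.{0} := fun n => dec (if n < k then d n else 0)
  have hu : {ξ | ξ < a k ∧ switch (glue x a Φ₀) F ξ ≠ x (a k) ξ}.Finite :=
    finite_ne_trans ((finite_switch_ne _ F).subset fun ξ hξ => hξ.2)
      (finite_ne_symm (Coherent.finite_glue_ne hx hlt Φ₀ le_rfl))
  obtain ⟨t, ht, hi, hlen⟩ := hcl (BinSeq.ofFun (a k) (hlt k) _) (ofFun_mem_tree _ hu) (ha.lt k)
  obtain ⟨hle, hut⟩ := isInit_iff.1 hi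
  obtain ⟨m, hkm, hm⟩ : ∃ m, k < m ∧ t.len < a m := by
    obtain ⟨m, hm⟩ := ha.exists_lt _ hlen
    exact ⟨max m (k + 1), by omega, hm.trans_le (ha.strictMono.monotone (le_max_left _ _))⟩
  let g : Ordinal.{0} → Bool := fun ξ => if ξ < t.len then t.toFun ξ else x (a m) ξ
  have hg : {ξ | ξ < a m ∧ g ξ ≠ x (a m) ξ}.Finite := by
    refine (finite_ne_trans (hE.subset ht) (hx (a m) (hlt m) t.len hm.le)).subset fun ξ hξ => ?_
    have h1 : ξ < t.len := by
      by_contra h1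
      exact hξ.2 (if_neg h1)
    exact ⟨h1, by simpa [g, h1] using hξ.2⟩
  have hgE : BinSeq.ofFun (a m) (hlt m) g ∈ E := by
    refine hE.isOpen t ht _ (ofFun_mem_tree _ hg) (isInit_iff.2 ⟨hm.le, fun ξ hξ => ?_⟩)
    rw [BinSeq.toFun_ofFun _ _ (hξ.trans hm)]
    simp [g, hξ]
  -- By coherence the target `g` differs from the `F`-switched `x (a n)` finitely often; switching
  -- on exactly that set steers the branch along `g`.
  have hG : ∀ n ≤ m, ∃ j, ∀ ξ < a n, ξ ∈ dec j ↔ g ξ ≠ switch (x (a n)) F ξ := by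
    intro n hn
    have hnm := ha.strictMono.monotone hn
    have hfin : {ξ | ξ < a n ∧ g ξ ≠ switch (x (a n)) F ξ}.Finite :=
      finite_ne_trans (finite_ne_trans (finite_ne_mono hnm hg)
        (finite_ne_symm (hx (a m) (hlt m) (a n) hnm)))
        (finite_ne_symm ((finite_switch_ne (x (a n)) F).subset fun ξ hξ => hξ.2))
    obtain ⟨j, hj⟩ := hdec hfin.toFinset fun ξ hξ =>
      ((hfin.mem_toFinset.1 hξ).1).trans (ha.lt n)
    exact ⟨j, fun ξ hξ => by rw [hj, hfin.mem_toFinset]; exact and_iff_right hξ⟩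
  choose! j hj using hG
  obtain ⟨y', k', hk, hy, hdecides, h1, h2⟩ := hd (fun n => if n = k then 0 else j n) m
  refine ⟨y', k', m, hk, hy, hdecides, _, hgE, rfl, fun ξ hξ => ?_⟩
  rw [BinSeq.toFun_ofFun _ _ hξ]
  have hp := lt_piece hξ
  rcases le_or_gt (piece a ξ) k with hpk | hpk
  · have hξk : ξ < a k := hp.trans_le (ha.strictMono.monotone hpk)
    have hξt : ξ < t.len := hξk.trans_le hle
    have h3 : g ξ = switch (glue x a Φ₀) F ξ := by
      have := hut ξ hξk
      rw [BinSeq.toFun_ofFun _ _ hξk] at this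
      simp only [g, hξt, if_true, this]
    rw [h3, switch, switch, glue_congr (fun _ _ => rfl) (fun n hn => ?_) hξk]
    rcases hn.eq_or_lt with rfl | hn
    · simp [Φ₀, h2]
    · simp [Φ₀, hn, h1 n hn]
  · have h3 := hj _ (piece_le hξ) ξ hp
    have hxor : ∀ b c e : Bool, b = ((c ^^ decide (b ≠ (c ^^ e))) ^^ e) := by decide
    rw [switch, glue, h2 _ hpk.le, if_neg hpk.ne', switch, decide_eq_decide.2 h3]
    exact hxor _ _ _

/-! ### Tokens -/

theorem exists_HC {S : Set ZFSet.{0}} (hS : S.Countable) (h : ∀ z ∈ S, IsHC z) :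
    ∃ z : HC, ∀ w, w ∈ z.1 ↔ w ∈ S := by
  have := hS.to_subtype
  have hm : ∀ z, z ∈ ZFSet.range (fun z : S => z.1) ↔ z ∈ S := by simp
  exact ⟨⟨ZFSet.range (fun z : S => z.1), isHC_of_forall_mem (hS.mono fun z hz => (hm z).1 hz)
    fun z hz => h z ((hm z).1 hz)⟩, hm⟩

theorem isHC_toZFSet {α : Ordinal.{0}} (hα : α < ω₁) : IsHC α.toZFSet := by
  induction α using WellFoundedLT.induction with
  | _ α ih =>
  refine isHC_of_forall_mem (((countable_Iio hα).image Ordinal.toZFSet).mono fun z hz => ?_)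
    fun z hz => ?_
  · obtain ⟨β, hβ, rfl⟩ := Ordinal.mem_toZFSet_iff.1 hz
    exact ⟨β, hβ, rfl⟩
  · obtain ⟨β, hβ, rfl⟩ := Ordinal.mem_toZFSet_iff.1 hz
    exact ih β hβ (hβ.trans hα)

/-- A condition of `2^{<ω}` together with the codes of a finite set and of a finite sequence. -/
noncomputable def token (c : Datum → Ordinal.{0}) (σ : ZFSet.{0}) (F : Finset Ordinal.{0})
    (l : List (Ordinal.{0} × Finset Ordinal.{0})) : ZFSet.{0} :=
  {σ, (c (.inl F) + 1).toZFSet, (c (.inr l) + 1).toZFSet}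

theorem empty_mem_toZFSet (γ : Ordinal.{0}) : ∅ ∈ (γ + 1).toZFSet :=
  Ordinal.mem_toZFSet_iff.2 ⟨0, by simp, Ordinal.toZFSet_zero⟩

theorem empty_notMem_restr (y : ℕ → Bool) (k : ℕ) : ∅ ∉ restr y k := by
  intro h
  obtain ⟨i, hi⟩ := ZFSet.mem_range.1 h
  have : ({Ordinal.toZFSet (i : ℕ)} : ZFSet.{0}) ∈ (∅ : ZFSet.{0}) := by
    rw [← hi]
    simp [ZFSet.pair]
  exact ZFSet.notMem_empty _ this

/-- The shift by one puts `∅` into the ordinal, whereas the elements of a finite sequence are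
Kuratowski pairs and so nonempty. Without the shift the empty sequence would equal the ordinal `0`.
-/
theorem restr_ne_toZFSet (y : ℕ → Bool) (k : ℕ) (γ : Ordinal.{0}) :
    restr y k ≠ (γ + 1).toZFSet :=
  fun h => empty_notMem_restr y k (h ▸ empty_mem_toZFSet γ)

theorem add_one_toZFSet_inj {γ δ : Ordinal.{0}} (h : (γ + 1).toZFSet = (δ + 1).toZFSet) : γ = δ := by
  have := Ordinal.toZFSet_injective h
  exact Order.add_one_inj.1 this

theorem mem_token {c : Datum → Ordinal.{0}} {σ z : ZFSet.{0}} {F : Finset Ordinal.{0}}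
    {l : List (Ordinal.{0} × Finset Ordinal.{0})} : z ∈ token c σ F l ↔
      z = σ ∨ z = (c (.inl F) + 1).toZFSet ∨ z = (c (.inr l) + 1).toZFSet := by
  simp [token]

theorem restr_mem_token {c : Datum → Ordinal.{0}} {σ : ZFSet.{0}} {y : ℕ → Bool} {k : ℕ}
    {F : Finset Ordinal.{0}} {l : List (Ordinal.{0} × Finset Ordinal.{0})}
    (h : restr y k ∈ token c σ F l) : restr y k = σ := by
  rcases mem_token.1 h with h | h | h
  · exact h
  · exact absurd h (restr_ne_toZFSet _ _ _)
  · exact absurd h (restr_ne_toZFSet _ _ _)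

/-- The data whose entries are countable ordinals. -/
def countableData : Set Datum := {z | ∀ ξ ∈ z.supp, ξ < ω₁}

/-- A token is an unordered triple, which keeps the formula defining `d` simple. Its components can
still be told apart: finite sequences are not shifted codes, and `c` is injective on sets and lists
together. -/
theorem code_mem_token {c : Datum → Ordinal.{0}} (hc : Set.InjOn c countableData) {y : ℕ → Bool}
    {k : ℕ} {F : Finset Ordinal.{0}} {l : List (Ordinal.{0} × Finset Ordinal.{0})} {z : Datum}
    (hz : z ∈ countableData) (hF : .inl F ∈ countableData) (hl : .inr l ∈ countableData)
    (h : (c z + 1).toZFSet ∈ token c (restr y k) F l) : z = .inl F ∨ z = .inr l := by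
  rcases mem_token.1 h with h | h | h
  · exact absurd h.symm (restr_ne_toZFSet _ _ _)
  · exact Or.inl (hc hz hF (add_one_toZFSet_inj h))
  · exact Or.inr (hc hz hl (add_one_toZFSet_inj h))

theorem token_inj {c : Datum → Ordinal.{0}} (hc : Set.InjOn c countableData) {y y' : ℕ → Bool}
    {k k' : ℕ} {F F' : Finset Ordinal.{0}} {l l' : List (Ordinal.{0} × Finset Ordinal.{0})}
    (hF : .inl F ∈ countableData) (hl : .inr l ∈ countableData)
    (hF' : .inl F' ∈ countableData) (hl' : .inr l' ∈ countableData)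
    (h : token c (restr y k) F l = token c (restr y' k') F' l') : F = F' ∧ l = l' := by
  have h1 := code_mem_token hc hF hF' hl' (h ▸ mem_token.2 (Or.inr (Or.inl rfl)))
  have h2 := code_mem_token hc hl hF' hl' (h ▸ mem_token.2 (Or.inr (Or.inr rfl)))
  simpa using And.intro h1 h2

theorem singleton_empty_notMem_restr (y : ℕ → Bool) (k : ℕ) : {∅} ∉ restr y k := by
  intro h
  obtain ⟨i, hi⟩ := ZFSet.mem_range.1 h
  have : ({Ordinal.toZFSet (i : ℕ)} : ZFSet.{0}) ∈ ({∅} : ZFSet.{0}) := by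
    rw [← hi]
    simp [ZFSet.pair]
  have h' : Ordinal.toZFSet (i : ℕ) ∈ ({Ordinal.toZFSet (i : ℕ)} : ZFSet.{0}) :=
    ZFSet.mem_singleton.2 rfl
  rw [ZFSet.mem_singleton.1 this] at h'
  exact ZFSet.notMem_empty _ h'

/-- With `token_ne_tag`, this shows that no token is a value of the sequence `s`, since each value
contains the tag `{{∅}}` or equals it. -/
theorem tag_notMem_token {c : Datum → Ordinal.{0}} {y : ℕ → Bool} {k : ℕ}
    {F : Finset Ordinal.{0}} {l : List (Ordinal.{0} × Finset Ordinal.{0})} :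
    {{∅}} ∉ token c (restr y k) F l := by
  have h0 : ∀ γ : Ordinal.{0}, ({{∅}} : ZFSet.{0}) ≠ (γ + 1).toZFSet := by
    intro γ h
    have := empty_mem_toZFSet γ
    rw [← h, ZFSet.mem_singleton] at this
    have h1 : (∅ : ZFSet.{0}) ∈ ({∅} : ZFSet.{0}) := ZFSet.mem_singleton.2 rfl
    rw [← this] at h1
    exact ZFSet.notMem_empty ∅ h1
  intro h
  rcases mem_token.1 h with h | h | h
  · exact singleton_empty_notMem_restr y k (h ▸ ZFSet.mem_singleton.2 rfl)
  · exact h0 _ h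
  · exact h0 _ h

theorem token_ne_tag {c : Datum → Ordinal.{0}} {y : ℕ → Bool} {k : ℕ}
    {F : Finset Ordinal.{0}} {l : List (Ordinal.{0} × Finset Ordinal.{0})} :
    token c (restr y k) F l ≠ {{∅}} := by
  intro h
  have h1 : restr y k ∈ token c (restr y k) F l := mem_token.2 (Or.inl rfl)
  rw [h, ZFSet.mem_singleton] at h1
  exact empty_notMem_restr y k (h1 ▸ ZFSet.mem_singleton.2 rfl)

theorem countable_tokens (c : Datum → Ordinal.{0}) {S : Set Datum} (hS : S.Countable) :
    {w | ∃ y k F l, .inl F ∈ S ∧ .inr l ∈ S ∧ w = token c (restr y k) F l}.Countable := by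
  obtain ⟨Q, hQ, hQm⟩ := exists_set fun _ => True
  have h1 : {σ | σ ∈ Q}.Countable := countable_mem ⟨Q, hQ⟩
  have h2 := hS.preimage (Sum.inl_injective (α := Finset Ordinal.{0})
    (β := List (Ordinal.{0} × Finset Ordinal.{0})))
  have h3 := hS.preimage (Sum.inr_injective (α := Finset Ordinal.{0})
    (β := List (Ordinal.{0} × Finset Ordinal.{0})))
  refine ((h1.prod (h2.prod h3)).image fun p => token c p.1 p.2.1 p.2.2).mono ?_
  rintro _ ⟨y, k, F, l, hF, hl, rfl⟩
  exact ⟨(restr y k, F, l), ⟨(hQm _).2 ⟨⟨y, k, rfl⟩, trivial⟩, hF, hl⟩, rfl⟩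

theorem isHC_token {c : Datum → Ordinal.{0}} (hc : ∀ z ∈ countableData, c z < ω₁) {y : ℕ → Bool}
    {k : ℕ} {F : Finset Ordinal.{0}} {l : List (Ordinal.{0} × Finset Ordinal.{0})}
    (hF : .inl F ∈ countableData) (hl : .inr l ∈ countableData) :
    IsHC (token c (restr y k) F l) := by
  refine isHC_of_forall_mem ((Set.toFinite {restr y k, (c (.inl F) + 1).toZFSet,
    (c (.inr l) + 1).toZFSet}).countable.mono fun z hz => ?_) fun z hz => ?_
  · simpa [token] using hz
  · rcases mem_token.1 hz with rfl | rfl | rfl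
    · exact isHC_restr y k
    · exact isHC_toZFSet (add_one_lt_omega_one (hc _ hF))
    · exact isHC_toZFSet (add_one_lt_omega_one (hc _ hl))

/-! ### Continuous sequences and finite descriptions of gluings -/

/-- A continuous sequence may be prescribed at zero and at the successor ordinals. -/
theorem exists_isContinuousSeq (z : HC) (S : Ordinal.{0} → HC) :
    ∃ s, IsContinuousSeq s ∧ s 0 = z.1 ∧ (∀ β, s (β + 1) = (S β).1) ∧
      ∀ α, Order.IsSuccLimit α → ∀ w, w ∈ s α ↔ ∃ β < α, s β = w := by
  let s : Ordinal.{0} → ZFSet.{0} := fun α => Ordinal.limitRecOn α z.1 (fun β _ => (S β).1)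
    fun α _ f => ZFSet.range fun β : Set.Iio α => f β.1 β.2
  have h0 : s 0 = z.1 := Ordinal.limitRecOn_zero _ _ _
  have hs : ∀ β, s (β + 1) = (S β).1 := fun β => Ordinal.limitRecOn_add_one _ _ _ _
  have hl : ∀ α, Order.IsSuccLimit α → s α = ZFSet.range (fun β : Set.Iio α => s β) :=
    fun α hα => Ordinal.limitRecOn_limit _ _ _ _ hα
  have hl' : ∀ α, Order.IsSuccLimit α → ∀ w, w ∈ s α ↔ ∃ β < α, s β = w := by
    intro α hα w
    rw [hl α hα, ZFSet.mem_range]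
    exact ⟨fun ⟨β, h⟩ => ⟨β.1, β.2, h⟩, fun ⟨β, hβ, h⟩ => ⟨⟨β, hβ⟩, h⟩⟩
  refine ⟨s, ⟨fun α => ?_, fun α _ hα => hl α hα⟩, h0, hs, hl'⟩
  induction α using WellFoundedLT.induction with
  | _ α ih =>
  intro hα
  rcases Ordinal.zero_or_succ_or_isSuccLimit α with rfl | ⟨β, rfl⟩ | hlim
  · exact h0 ▸ z.2
  · rw [Order.succ_eq_add_one, hs]
    exact (S β).2
  · refine isHC_of_forall_mem (((countable_Iio hα).image s).mono fun w hw => ?_) fun w hw => ?_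
    · obtain ⟨β, hβ, rfl⟩ := (hl' α hlim w).1 hw
      exact ⟨β, hβ, rfl⟩
    · obtain ⟨β, hβ, rfl⟩ := (hl' α hlim w).1 hw
      exact ih β hβ (hβ.trans hα)

/-- The finite sequence of the pairs `(a n, Φ n)` for `n ≤ m`. -/
def steps (a : ℕ → Ordinal.{0}) (Φ : ℕ → Finset Ordinal.{0}) (m : ℕ) :
    List (Ordinal.{0} × Finset Ordinal.{0}) :=
  (List.range (m + 1)).map fun n => (a n, Φ n)

theorem steps_inj {a a' : ℕ → Ordinal.{0}} {Φ Φ' : ℕ → Finset Ordinal.{0}} {m m' : ℕ}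
    (h : steps a Φ m = steps a' Φ' m') :
    m = m' ∧ (∀ n ≤ m, a n = a' n) ∧ ∀ n ≤ m, Φ n = Φ' n := by
  have hlen : m = m' := by simpa [steps] using congrArg List.length h
  subst hlen
  have h' : ∀ n ≤ m, (a n, Φ n) = (a' n, Φ' n) := fun n hn =>
    List.map_inj_left.1 h n (List.mem_range.2 (Nat.lt_succ_of_le hn))
  exact ⟨rfl, fun n hn => congrArg Prod.fst (h' n hn), fun n hn => congrArg Prod.snd (h' n hn)⟩

theorem supp_steps_lt {a : ℕ → Ordinal.{0}} {Φ : ℕ → Finset Ordinal.{0}} {m : ℕ} {α : Ordinal.{0}}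
    (ha : ∀ n, a n < α) (hΦ : ∀ n, ∀ ξ ∈ Φ n, ξ < α) :
    ∀ ξ ∈ Datum.supp (.inr (steps a Φ m)), ξ < α := by
  intro ξ hξ
  simp only [Datum.supp, Finset.mem_biUnion, List.mem_toFinset, steps, List.mem_map] at hξ
  obtain ⟨p, ⟨n, -, rfl⟩, h⟩ := hξ
  rcases Finset.mem_insert.1 h with rfl | h
  · exact ha n
  · exact hΦ n ξ h

/-! ### Sealing a dense open set -/

/-- `dec` enumerates the finite subsets of `α`. -/
structure IsEnum (dec : ℕ → Finset Ordinal.{0}) (α : Ordinal.{0}) : Prop where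
  lt : ∀ j, ∀ ξ ∈ dec j, ξ < α
  surj : ∀ F : Finset Ordinal.{0}, (∀ ξ ∈ F, ξ < α) → ∃ j, dec j = F

theorem exists_isEnum {α : Ordinal.{0}} (hα : α < ω₁) : ∃ dec, IsEnum dec α := by
  have h : {F : Finset Ordinal.{0} | ∀ ξ ∈ F, ξ < α}.Countable :=
    (countable_supp_subset (countable_Iio hα)).preimage Sum.inl_injective
  obtain ⟨dec, hdec⟩ := h.exists_eq_range ⟨∅, by simp⟩
  exact ⟨dec, fun j => hdec.symm.subset ⟨j, rfl⟩, fun F hF => hdec.subset hF⟩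

/-- The tokens whose finite set and finite sequence describe a node that belongs to `E`, with codes
at most `β`, and a set that is no token. -/
def acceptedTokens (c : Datum → Ordinal.{0}) (x : Ordinal.{0} → Ordinal.{0} → Bool)
    (E : Set BinSeq) (β : Ordinal.{0}) : Set ZFSet.{0} :=
  insert {{∅}} {w | ∃ y k F a Φ m, (.inl F ∈ countableData ∧ c (.inl F) ≤ β) ∧
    (.inr (steps a Φ m) ∈ countableData ∧ c (.inr (steps a Φ m)) ≤ β) ∧
    Passes E (a m) (switch (glue x a Φ) F) ∧ w = token c (restr y k) F (steps a Φ m)}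

/-- The tokens of the conditions that decide an initial segment of the branch along the ladder
`a`. -/
def ladderTokens (c : Datum → Ordinal.{0}) (a : ℕ → Ordinal.{0}) (dec : ℕ → Finset Ordinal.{0})
    (α : Ordinal.{0}) : Set ZFSet.{0} :=
  {w | ∃ y k F m, (∀ ξ ∈ F, ξ < α) ∧ Decides y k m ∧
    w = token c (restr y k) F (steps a (fun n => dec (rowIdx y n)) m)}

theorem isHC_singleton_empty : IsHC {∅} :=
  isHC_singleton (by simpa using isHC_natCast 0)

/-- The bound `β` on the codes keeps the set countable, since `c` is injective. -/
theorem exists_acceptedTokens {c : Datum → Ordinal.{0}} (hc : Set.InjOn c countableData)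
    (hc' : ∀ z ∈ countableData, c z < ω₁) (x : Ordinal.{0} → Ordinal.{0} → Bool)
    (E : Set BinSeq) {β : Ordinal.{0}} (hβ : β < ω₁) :
    ∃ z : HC, ∀ w, w ∈ z.1 ↔ w ∈ acceptedTokens c x E β := by
  have hS : {z | z ∈ countableData ∧ c z ≤ β}.Countable :=
    Set.MapsTo.countable_of_injOn (t := Set.Iio (β + 1)) (fun z hz => Order.lt_add_one_iff.2 hz.2)
      (hc.mono fun z hz => hz.1) (countable_Iio (add_one_lt_omega_one hβ))
  refine exists_HC (((countable_tokens c hS).mono ?_).insert _) ?_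
  · rintro _ ⟨y, k, F, a, Φ, m, hF, hl, -, rfl⟩
    exact ⟨y, k, F, _, hF, hl, rfl⟩
  · rintro _ (rfl | ⟨y, k, F, a, Φ, m, hF, hl, -, rfl⟩)
    · exact isHC_singleton isHC_singleton_empty
    · exact isHC_token hc' hF.1 hl.1

theorem exists_ladderTokens {c : Datum → Ordinal.{0}} (hc' : ∀ z ∈ countableData, c z < ω₁)
    {α : Ordinal.{0}} (hα : α < ω₁) {a : ℕ → Ordinal.{0}} (ha : IsLadder a α)
    {dec : ℕ → Finset Ordinal.{0}} (hdec : IsEnum dec α) :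
    ∃ z : HC, ∀ w, w ∈ z.1 ↔ w ∈ ladderTokens c a dec α := by
  refine exists_HC ((countable_tokens c (countable_supp_subset (countable_Iio hα))).mono ?_) ?_
  · rintro _ ⟨y, k, F, m, hF, -, rfl⟩
    exact ⟨y, k, F, _, hF, supp_steps_lt ha.lt fun n => hdec.lt _, rfl⟩
  · rintro _ ⟨y, k, F, m, hF, -, rfl⟩
    exact isHC_token hc' (fun ξ hξ => (hF ξ hξ).trans hα)
      fun ξ hξ => (supp_steps_lt ha.lt (fun n => hdec.lt _) ξ hξ).trans hα

/-- If the branch through a limit level `α` is given by a Cohen real over a suitable elementary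
submodel, then this level is contained in the given dense open set. -/
theorem level_subset_of_cohen {c : Datum → Ordinal.{0}} (hc : Set.InjOn c countableData)
    {x : Ordinal.{0} → Ordinal.{0} → Bool} (hx : Coherent x) {E : Set BinSeq}
    (hE : IsDenseOpen (tree x) E) {α : Ordinal.{0}} (hα : α < ω₁) (hlim : Order.IsSuccLimit α)
    {a : ℕ → Ordinal.{0}} (ha : IsLadder a α) {dec : ℕ → Finset Ordinal.{0}} (hdec : IsEnum dec α)
    {b : ℕ → Bool} (hb : x α = glue x a fun n => dec (rowIdx b n))
    (hcl : ∀ t ∈ tree x, t.len < α → ∃ t' ∈ E, IsInit t t' ∧ t'.len < α)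
    (hcode : ∀ z : Datum, (∀ ξ ∈ z.supp, ξ < α) → c z < α)
    {s : Ordinal.{0} → ZFSet.{0}} (hs0 : s 0 = {{∅}})
    (hs : ∀ β < ω₁, ∀ w, w ∈ s (β + 1) ↔ w ∈ acceptedTokens c x E β)
    (hsl : ∀ α, Order.IsSuccLimit α → ∀ w, w ∈ s α ↔ ∃ β < α, s β = w)
    {r : HC → HC → Prop} {q k m : ZFSet.{0}} (hm : IsElementarySubmodel r m)
    (hq : ∀ w, w ∈ q ↔ ∃ y n, w = restr y n) (hk : ∀ w, w ∈ k ↔ w ∈ ladderTokens c a dec α)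
    (hqm : q ∈ m) (hkm : k ∈ m) (hsm : s α ∈ m) (hom : ∀ γ < α, (γ + 1).toZFSet ∈ m)
    (hcohen : ∀ e ∈ meagreCodes, e.1 ∈ m → b ∉ decode e) : level (tree x) α ⊆ E := by
  rintro t ⟨ht, hlen⟩
  obtain ⟨F, hF, htF⟩ := exists_switch_of_mem_level ht
  rw [hlen] at hF htF
  have hcd : ∀ z : Datum, (∀ ξ ∈ z.supp, ξ < α) → z ∈ countableData :=
    fun z hz ξ hξ => (hz ξ hξ).trans hα
  let L : (ℕ → Bool) → ℕ → List (Ordinal.{0} × Finset Ordinal.{0}) :=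
    fun y => steps a fun n => dec (rowIdx y n)
  have hL : ∀ y n, ∀ ξ ∈ Datum.supp (.inr (L y n)), ξ < α :=
    fun y n => supp_steps_lt ha.lt fun _ => hdec.lt _
  obtain ⟨d, hd, hdm⟩ := exists_set fun σ =>
    ∃ p ∈ k, ∃ u ∈ s α, p ∈ u ∧ (c (.inl F) + 1).toZFSet ∈ p ∧ σ ∈ p
  have hdm' : ({d} : ZFSet.{0}) ∈ m := hm.singleton_mem hqm hkm hsm (hom _ (hcode (.inl F) hF)) hd
    fun σ => by rw [hdm, hq]
  have hdense : IsDenseSet d := by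
    refine ⟨fun σ hσ => ((hdm σ).1 hσ).1, fun y n => ?_⟩
    obtain ⟨y', n', i, hn, hy, hdecides, hp⟩ := exists_decides_passes hx hα ha hdec.surj hE hcl F y n
    -- The stage at which both codes are admitted; it is below `α` because `α` is closed under
    -- coding.
    let δ := max (c (.inl F)) (c (.inr (L y' i)))
    have hδ : δ < α := max_lt (hcode _ hF) (hcode _ (hL y' i))
    refine ⟨y', n', hn, hy, (hdm _).2 ⟨⟨y', n', rfl⟩, token c (restr y' n') F (L y' i),
      (hk _).2 ⟨y', n', F, i, hF, hdecides, rfl⟩, s (δ + 1),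
      (hsl α hlim _).2 ⟨_, hlim.add_one_lt hδ, rfl⟩, (hs δ (hδ.trans hα) _).2 (Or.inr
      ⟨y', n', F, a, _, i, ⟨hcd _ hF, le_max_left _ _⟩, ⟨hcd _ (hL y' i), le_max_right _ _⟩, hp, rfl⟩),
      mem_token.2 (Or.inr (Or.inl rfl)), mem_token.2 (Or.inl rfl)⟩⟩
  let e : HC := ⟨{d}, hm.1 _ hdm'⟩
  have he : b ∉ decode e := hcohen e (fun D hD => ZFSet.mem_singleton.1 hD ▸ hdense) hdm'
  obtain ⟨n, hn⟩ : ∃ n, restr b n ∈ d := by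
    by_contra! h
    exact he ⟨d, ZFSet.mem_singleton.2 rfl, h⟩
  obtain ⟨-, p, hp, u, hu, hpu, hFp, hbp⟩ := (hdm _).1 hn
  obtain ⟨y, n', F', i, hF', hdecides, rfl⟩ := (hk p).1 hp
  obtain rfl : F = F' := by
    have h := code_mem_token hc (hcd (.inl F) hF) (hcd (.inl F') hF') (hcd _ (hL y i)) hFp
    simpa using h
  obtain ⟨rfl, hby⟩ := restr_inj (restr_mem_token hbp)
  have hpass : Passes E (a i) (switch (glue x a fun n => dec (rowIdx y n)) F) := by
    -- The set `u` is some `s β` with `β < α`, and only successor stages list tokens; zero and limit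
    -- stages have to be excluded.
    have hacc : ∃ β < ω₁, token c (restr y n) F (L y i) ∈ acceptedTokens c x E β := by
      obtain ⟨β, hβ, rfl⟩ := (hsl α hlim u).1 hu
      rcases Ordinal.zero_or_succ_or_isSuccLimit β with rfl | ⟨γ, rfl⟩ | hβl
      · rw [hs0, ZFSet.mem_singleton] at hpu
        have h1 := empty_mem_toZFSet (c (.inl F))
        rw [ZFSet.mem_singleton.1 ((ZFSet.ext_iff.1 hpu _).1 hFp)] at h1
        exact absurd h1 (ZFSet.notMem_empty _)
      · have hγ : γ < ω₁ := (Order.lt_succ γ).trans (hβ.trans hα)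
        exact ⟨γ, hγ, (hs γ hγ _).1 hpu⟩
      · exfalso
        -- At a limit `β` the token would itself be a value `s γ`, but every such value is or
        -- contains the tag.
        obtain ⟨γ, hγ, h1⟩ := (hsl β hβl _).1 hpu
        have h2 : ({{∅}} : ZFSet.{0}) ∈ s γ ∨ s γ = {{∅}} := by
          rcases Ordinal.zero_or_succ_or_isSuccLimit γ with rfl | ⟨δ, rfl⟩ | hγl
          · exact Or.inr hs0
          · have hδ : δ < ω₁ := (Order.lt_succ δ).trans (hγ.trans (hβ.trans hα))
            exact Or.inl ((hs δ hδ _).2 (Or.inl rfl))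
          · exact Or.inl ((hsl γ hγl _).2 ⟨0, hγl.bot_lt, hs0⟩)
        rw [h1] at h2
        exact h2.elim tag_notMem_token token_ne_tag
    obtain ⟨β, -, h1 | ⟨y', n', F', a', Φ', i', hF1, hl1, hp1, h1⟩⟩ := hacc
    · exact absurd h1 token_ne_tag
    · obtain ⟨rfl, h2⟩ := token_inj hc (hcd (.inl F) hF) (hcd _ (hL y i)) hF1.1 hl1.1 h1
      -- The token may have been accepted through another ladder and other finite sets, but they
      -- agree up to `i` and so give the same node.
      obtain ⟨rfl, h3, h4⟩ := steps_inj h2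
      rw [← h3 i le_rfl] at hp1
      exact hp1.congr fun ξ hξ => congrArg (· ^^ decide (ξ ∈ F)) (glue_congr h3 h4 hξ).symm
  obtain ⟨t', ht', hlen', ht'f⟩ := hpass
  refine hE.isOpen t' ht' t ht (isInit_iff.2 ⟨?_, fun ξ hξ => ?_⟩)
  · rw [hlen', hlen]
    exact (ha.lt i).le
  · rw [hlen'] at hξ
    rw [ht'f ξ hξ, htF ξ (hξ.trans (ha.lt i)), hb]
    refine congrArg (· ^^ decide (ξ ∈ F)) (glue_congr (fun _ _ => rfl) (fun j hj => ?_) hξ)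
    rw [hdecides.rowIdx_congr hby hj]

/-- A club of limit levels below which a dense open subset of the tree is dense, and which are
closed under the coding of finite objects. -/
theorem exists_isClub_dense {c : Datum → Ordinal.{0}} (hc' : ∀ z ∈ countableData, c z < ω₁)
    {x : Ordinal.{0} → Ordinal.{0} → Bool} {E : Set BinSeq} (hE : IsDenseOpen (tree x) E) :
    ∃ C : Set (Set.Iio (ω₁ : Ordinal.{0})), IsClub C ∧ ∀ α ∈ C, Order.IsSuccLimit α.1 ∧
      (∀ t ∈ tree x, t.len < α.1 → ∃ t' ∈ E, IsInit t t' ∧ t'.len < α.1) ∧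
      ∀ z : Datum, (∀ ξ ∈ z.supp, ξ < α.1) → c z < α.1 := by
  choose! g hg hgi using hE.dense
  have hf : ∀ β : Ordinal.{0}, β < ω₁ → ∃ δ < ω₁, (∀ t ∈ level (tree x) β, (g t).len < δ) ∧
      ∀ z : Datum, (∀ ξ ∈ z.supp, ξ ≤ β) → c z < δ := by
    intro β hβ
    have hβ' := add_one_lt_omega_one hβ
    obtain ⟨δ, hδ, h⟩ := exists_lt_of_countable
      (((countable_level_tree x hβ).image fun t => (g t).len).union
        ((countable_supp_subset (countable_Iio hβ')).image c)) (by
        rintro _ (⟨t, -, rfl⟩ | ⟨z, hz, rfl⟩)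
        · exact (g t).len_lt
        · exact hc' z fun ξ hξ => lt_trans (hz ξ hξ) hβ')
    exact ⟨δ, hδ, fun t ht => h _ (Or.inl ⟨t, ht, rfl⟩),
      fun z hz => h _ (Or.inr ⟨z, fun ξ hξ => Order.lt_add_one_iff.2 (hz ξ hξ), rfl⟩)⟩
  choose! f hf1 hf2 hf3 using hf
  refine ⟨_, isClub_closed hf1, fun α hα => ⟨hα.1, fun t ht hlen => ⟨g t, hg t ht, hgi t ht, ?_⟩,
    fun z hz => ?_⟩⟩
  · exact (hf2 _ t.len_lt t ⟨ht, rfl⟩).trans (hα.2 _ hlen)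
  · have hβ : z.supp.sup id < α.1 := (Finset.sup_lt_iff hα.1.bot_lt).2 hz
    exact (hf3 _ (lt_trans hβ α.2) z fun ξ hξ => Finset.le_sup (f := id) hξ).trans (hα.2 _ hβ)

end ElementaryDiamond

/-! ### Construction of the Suslin tree from the diamond -/

theorem mainTheorem8
    (r : ElementaryDiamond.HC → ElementaryDiamond.HC → Prop)
    (hr : IsWellOrder ElementaryDiamond.HC r)
    (h : ElementaryDiamond.ELDiamond r ElementaryDiamond.nonM) :
    ∃ T : Set ElementaryDiamond.BinSeq, ElementaryDiamond.IsSuslinTree T := by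
  open ElementaryDiamond in
  obtain ⟨c, hc, hc'⟩ := exists_code
  obtain ⟨q, hqc, hq⟩ := exists_set fun _ => True
  have ha : ∀ α : Ordinal.{0}, ∃ a, α < ω₁ → Order.IsSuccLimit α → IsLadder a α := by
    intro α
    by_cases hα : α < ω₁ ∧ Order.IsSuccLimit α
    · obtain ⟨a, ha⟩ := exists_isLadder hα.1 hα.2
      exact ⟨a, fun _ _ => ha⟩
    · exact ⟨fun _ => 0, fun h1 h2 => absurd ⟨h1, h2⟩ hα⟩
  choose a ha using ha
  have hdec : ∀ α : Ordinal.{0}, ∃ dec, α < ω₁ → IsEnum dec α := by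
    intro α
    by_cases hα : α < ω₁
    · obtain ⟨dec, hdec⟩ := exists_isEnum hα
      exact ⟨dec, fun _ => hdec⟩
    · exact ⟨fun _ => ∅, fun h1 => absurd h1 hα⟩
  choose dec hdec using hdec
  -- One sequence carries all parameters: `2^{<ω}` at `0`, the ordinals that serve as shifted codes
  -- at successors, and the ladder tokens at limits. Since the models increase, `M (α + 1)` contains
  -- all terms up to `α`.
  have hk : ∀ α : Ordinal.{0}, ∃ k : HC, (α = 0 → k.1 = q) ∧
      (∀ β, α = β + 1 → α < ω₁ → k.1 = α.toZFSet) ∧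
      (α < ω₁ → Order.IsSuccLimit α → ∀ w, w ∈ k.1 ↔ w ∈ ladderTokens c (a α) (dec α) α) := by
    intro α
    by_cases hα : α < ω₁
    swap
    · exact ⟨⟨q, hqc⟩, fun _ => rfl, fun _ _ h => absurd h hα, fun h => absurd h hα⟩
    rcases Ordinal.zero_or_succ_or_isSuccLimit α with rfl | ⟨β, rfl⟩ | hlim
    · exact ⟨⟨q, hqc⟩, fun _ => rfl, fun β hβ => absurd hβ (Order.succ_ne_bot β).symm,
        fun _ h => absurd h Order.not_isSuccLimit_bot⟩
    · exact ⟨⟨_, isHC_toZFSet hα⟩, fun h => absurd h (Order.succ_ne_bot β), fun _ _ _ => rfl,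
        fun _ h => absurd h (Order.not_isSuccLimit_succ β)⟩
    · obtain ⟨k, hk⟩ := exists_ladderTokens hc' hα (ha α hα hlim) (hdec α hα)
      refine ⟨k, fun h => absurd h hlim.bot_lt.ne', fun β hβ => ?_, fun _ _ => hk⟩
      subst hβ
      exact absurd hlim (Order.not_isSuccLimit_succ β)
  choose k hk0 hks hkl using hk
  obtain ⟨b, hb⟩ := h k
  obtain ⟨x, hxs, hxl⟩ := exists_glued a (fun α n => dec α (rowIdx (b α) n)) ha
  have hx := coherent_of_glued ha hxs hxl
  refine ⟨tree x, isSuslinTree_tree hx fun E hE => ?_⟩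
  have hS : ∀ β : Ordinal.{0}, ∃ z : HC, β < ω₁ → ∀ w, w ∈ z.1 ↔ w ∈ acceptedTokens c x E β := by
    intro β
    by_cases hβ : β < ω₁
    · obtain ⟨z, hz⟩ := exists_acceptedTokens hc hc' x E hβ
      exact ⟨z, fun _ => hz⟩
    · exact ⟨⟨q, hqc⟩, fun h1 => absurd h1 hβ⟩
  choose S hS using hS
  obtain ⟨z, hz⟩ := exists_HC (Set.countable_singleton ({∅} : ZFSet.{0})) (by
    rintro _ rfl
    exact isHC_singleton_empty)
  have hz' : z.1 = {{∅}} := by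
    ext w
    rw [hz, ZFSet.mem_singleton]
    rfl
  obtain ⟨s, hs, hs0, hss, hsl⟩ := exists_isContinuousSeq z S
  obtain ⟨M, hM, hmono, hmem, hstat⟩ := hb s hs
  obtain ⟨C, hC, hCα⟩ := exists_isClub_dense hc' hE
  -- The stationary set of Cohen stages meets the club on which `E` is dense below `α` and codes
  -- stay below `α`.
  obtain ⟨⟨α, hα⟩, hcohen, hαC⟩ := hstat hC
  obtain ⟨hlim, hcl, hcode⟩ := hCα _ hαC
  have hα1 : Order.succ α < ω₁ := by
    rw [Order.succ_eq_add_one]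
    exact add_one_lt_omega_one hα
  have hel := hM _ hα1
  have hkM : ∀ β ≤ α, (k β).1 ∈ M (Order.succ α) := fun β hβ =>
    hmono _ _ (Order.succ_le_succ hβ) hα1
      ((hM _ ((Order.succ_le_succ hβ).trans_lt hα1)).mem_of_triple_mem
        (hmem β (lt_of_le_of_lt hβ hα))).2.1
  refine ⟨α, hα, level_subset_of_cohen hc hx hE hα hlim (ha α hα hlim) (hdec α hα) (hxl α hα hlim)
    hcl hcode (hs0.trans hz') (fun β hβ w => by rw [hss, hS β hβ]) hsl hel
    (fun w => (hq w).trans (and_iff_left trivial)) (hkl α hα hlim) (hk0 0 rfl ▸ hkM 0 bot_le)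
    (hkM α le_rfl) (hel.mem_of_triple_mem (hmem α hα)).1 (fun γ hγ => ?_) hcohen⟩
  have hγ1 := hlim.add_one_lt hγ
  exact hks _ γ rfl (hγ1.trans hα) ▸ hkM _ hγ1.le
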